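/- **Setting.** Let $n\ge 2$, $q=\mathrm{diag}(q_{11},\dots,q_{nn})$ with $q_{jj}>0$, $Q=\prod_{j=1}^n]0,q_{jj}[$, $\tilde Q=\prod_{j=1}^n]-q_{jj}/2,q_{jj}/2[$. Functions are scalar-valued (real, or complex; the same choice throughout, with (bi)linearity over that field $\mathbb K$). For an open set $\Omega$ with $\mathrm{cl}\,\Omega\subseteq Q$ put $\mathbb S[\Omega]=\bigcup_{z\in\mathbb Z^n}(qz+\Omega)$ and $\mathbb S[\Omega]^-=\mathbb R^n\setminus\mathrm{cl}\,\mathbb S[\Omega]$. For $U$ open, $C^\infty(\mathrm{cl}\,U)$ is the space of functions on $\mathrm{cl}\,U$ that are smooth in $U$ and all of whose derivatives $D^\beta u$, $\beta\in\mathbb N^n$, extend continuously to $\mathrm{cl}\,U$ (the extension of $D^0u$ being $u$); the extension is still denoted $D^\beta u$. Let $\rho>0$. * For $U$ bounded and open, $C^0_{\omega,\rho}(\mathrm{cl}\,U)$ is the space of $u\in C^\infty(\mathrm{cl}\,U)$ with $\|u\|=\sup_{\beta}\frac{\rho^{|\beta|}}{|\beta|!}\sup_{\mathrm{cl}\,U}|D^\beta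 u|<\infty$. * $C^0_{q,\omega,\rho}(\mathrm{cl}\,\mathbb S[\Omega]^-)$ is the space of $q$-periodic $u\in C^\infty(\mathrm{cl}\,\mathbb S[\Omega]^-)$ with every $D^\beta u$ bounded and $\|u\|=\sup_{\beta}\frac{\rho^{|\beta|}}{|\beta|!}\sup_{\mathrm{cl}\,Q\setminus\Omega}|D^\beta u|<\infty$, the inner supremum being over the points of $\mathrm{cl}\,Q\setminus\Omega$ in the domain $\mathrm{cl}\,\mathbb S[\Omega]^-$ of $u$. * For $\mu>0$, $A^0_{q,\mu}$ is the space of continuous $q$-periodic functions $h$ on $\mathbb R^n\setminus q\mathbb Z^n$ with $\|h\|_{A^0_{q,\mu}}=\sup_{x\in\tilde Q\setminus\{0\}}|h(x)|\,|x|^\mu<\infty$. $A^1_{q,\mu}$ is the space of $h\in A^0_{q,\mu}$ of class $C^1$ with $\partial_jh\in A^0_{q,\mu+1}$ for all $j$, normed by $\|h\|_{A^0_{q,\mu}}+\sum_j\|\partial_jh\|_{A^0_{q,\mu+1}}$. * For $G$ open and bounded with $\mathrm{cl}\,G\cap q\mathbb Z^n=\emptyset$, $H_q^{\lambda,\rho}(G)$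 is the space of $h\in A^1_{q,\lambda}$ with $h_{|\mathrm{cl}\,G}\in C^0_{\omega,\rho}(\mathrm{cl}\,G)$, normed by $\|h\|_{A^1_{q,\lambda}}+\|h_{|\mathrm{cl}\,G}\|_{C^0_{\omega,\rho}(\mathrm{cl}\,G)}$; thus $H_q^{\lambda,\rho}(\emptyset)=A^1_{q,\lambda}$. For $x\in\mathbb R^n$ put $$\mathcal P^+[h,\varphi](x)=\int_\Omega h(x-y)\varphi(y)\,dy,\qquad \mathcal P^-[h,\varphi_{|Q\setminus\mathrm{cl}\,\Omega}](x)=\int_{Q\setminus\mathrm{cl}\,\Omega}h(x-y)\varphi(y)\,dy .$$ **Theorem.** Let $\lambda\in]0,n-1[$ and $\rho\in]0,+\infty[$. Let $\Omega$ be a bounded open Lipschitz subset of $\mathbb R^n$ (possibly empty or disconnected), and let $\Omega_2$ be an open subset of $\mathbb R^n$ with $\mathrm{cl}\,\Omega\subseteq\Omega_2\subseteq\mathrm{cl}\,\Omega_2\subseteq Q$. Let $G$ be an open relatively compact subset of $\mathbb R^n$ with $\mathrm{cl}\,G\cap q\mathbb Z^n=\emptyset$. If $\Omega\ne\emptyset$,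 assume that $G$ contains $\{t-s:\ t\in\mathrm{cl}\,Q\setminus\Omega_2,\ s\in\partial\Omega\}$; if $\Omega=\emptyset$, assume that $G=\emptyset$. Then: 1. If $\Omega\ne\emptyset$, then for all $(h,\varphi)\in H_q^{\lambda,\rho}(G)\times C^0_{\omega,\rho}(\mathrm{cl}\,\Omega)$ the integral defining $\mathcal P^+[h,\varphi](x)$ converges absolutely for every $x\in\mathbb R^n$, the restriction $\mathcal P^+[h,\varphi]_{|\mathrm{cl}\,\mathbb S[\Omega_2]^-}$ belongs to $C^0_{q,\omega,\rho}(\mathrm{cl}\,\mathbb S[\Omega_2]^-)$, and the map $(h,\varphi)\mapsto\mathcal P^+[h,\varphi]_{|\mathrm{cl}\,\mathbb S[\Omega_2]^-}$ from $H_q^{\lambda,\rho}(G)\times C^0_{\omega,\rho}(\mathrm{cl}\,\Omega)$ to $C^0_{q,\omega,\rho}(\mathrm{cl}\,\mathbb S[\Omega_2]^-)$ is bilinear and continuous. 2. For all $(h,\varphi)\in H_q^{\lambda,\rho}(G)\times C^0_{q,\omega,\rho}(\mathrm{cl}\,\mathbb S[\Omega]^-)$ the integral defining $\mathcal P^-[h,\varphi_{|Q\setminus\mathrm{cl}\,\Omega}](x)$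 converges absolutely for every $x\in\mathbb R^n$, the restriction $\mathcal P^-[h,\varphi_{|Q\setminus\mathrm{cl}\,\Omega}]_{|\mathrm{cl}\,\mathbb S[\Omega_2]^-}$ belongs to $C^0_{q,\omega,\rho}(\mathrm{cl}\,\mathbb S[\Omega_2]^-)$, and the map $(h,\varphi)\mapsto\mathcal P^-[h,\varphi_{|Q\setminus\mathrm{cl}\,\Omega}]_{|\mathrm{cl}\,\mathbb S[\Omega_2]^-}$ from $H_q^{\lambda,\rho}(G)\times C^0_{q,\omega,\rho}(\mathrm{cl}\,\mathbb S[\Omega]^-)$ to $C^0_{q,\omega,\rho}(\mathrm{cl}\,\mathbb S[\Omega_2]^-)$ is bilinear and continuous. -/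

import Mathlib

open Set Filter Topology MeasureTheory
open scoped ENNReal ContDiff

namespace PeriodicRoumieu

/-- Euclidean space `ℝⁿ`. -/
abbrev E (n : ℕ) := EuclideanSpace ℝ (Fin n)

noncomputable section

section Geometry

variable {n : ℕ}

/-- The open periodicity cell `Q = ∏ ]0, q_j[`. -/
def cell (q : Fin n → ℝ) : Set (E n) := {x | ∀ j, 0 < x j ∧ x j < q j}

/-- The open centred cell `∏ ]-q_j/2, q_j/2[`. -/
def centredCell (q : Fin n → ℝ) : Set (E n) := {x | ∀ j, -(q j / 2) < x j ∧ x j < q j / 2}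

/-- The point `q z`, where `q` is the diagonal matrix with entries `q_j` and `z ∈ ℤⁿ`. -/
def latticePoint (q : Fin n → ℝ) (z : Fin n → ℤ) : E n := WithLp.toLp 2 (fun j => q j * (z j : ℝ))

/-- The lattice `qℤⁿ`. -/
def lattice (q : Fin n → ℝ) : Set (E n) := Set.range (latticePoint q)

/-- The periodic set `S[Ω] = ⋃_z (q z + Ω)`. -/
def periodicSet (q : Fin n → ℝ) (Ω : Set (E n)) : Set (E n) :=
  ⋃ z : Fin n → ℤ, (fun x => latticePoint q z + x) '' Ω

/-- The exterior periodic set `S[Ω]⁻ = ℝⁿ ∖ cl S[Ω]`. -/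
def periodicExt (q : Fin n → ℝ) (Ω : Set (E n)) : Set (E n) := (closure (periodicSet q Ω))ᶜ

/-- Bounded open Lipschitz sets (possibly empty or disconnected): near each boundary point, the set
is, in suitable orthogonal coordinates, the strict epigraph of a Lipschitz function
of the `n - 1` coordinates orthogonal to a unit vector `v`. -/
structure IsBoundedLipschitz (Ω : Set (E n)) : Prop where
  isOpen : IsOpen Ω
  isBounded : Bornology.IsBounded Ω
  localGraph : ∀ x₀ ∈ frontier Ω, ∃ r : ℝ, 0 < r ∧ ∃ v : E n, ‖v‖ = 1 ∧
    ∃ (K : NNReal) (γ : (Submodule.span ℝ {v})ᗮ → ℝ), LipschitzWith K γ ∧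
      ∀ x ∈ Metric.ball x₀ r,
        (x ∈ Ω ↔ γ ((Submodule.span ℝ {v})ᗮ.orthogonalProjectionOnto x) < inner ℝ v x)

end Geometry

section Derivatives

variable {n : ℕ} {𝕜 : Type*} [RCLike 𝕜]

/-- Extension by zero of a function defined on a subset of `ℝⁿ`. -/
def zeroExt {s : Set (E n)} : (s → 𝕜) →ₗ[𝕜] (E n → 𝕜) :=
  Function.ExtendByZero.linearMap 𝕜 (Subtype.val : s → E n)

theorem zeroExt_apply {s : Set (E n)} (u : s → 𝕜) {x : E n} (hx : x ∈ s) :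
    zeroExt u x = u ⟨x, hx⟩ :=
  Subtype.val_injective.extend_apply u 0 ⟨x, hx⟩

/-- The partial derivative `∂f/∂x_j`. -/
def pderiv (j : Fin n) (f : E n → 𝕜) : E n → 𝕜 :=
  fun x => fderiv ℝ f x (EuclideanSpace.single j 1)

/-- The derivative `D^β f = ∂^{|β|} f / ∂x_1^{β_1} ... ∂x_n^{β_n}`. -/
def mderiv (β : Fin n → ℕ) (f : E n → 𝕜) : E n → 𝕜 :=
  (List.finRange n).foldr (fun j g => (pderiv j)^[β j] g) f

/-- Auxiliary: `D` acts linearly on germs of smooth functions. -/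
structure GermLinear (D : (E n → 𝕜) → (E n → 𝕜)) : Prop where
  smooth : ∀ f x, ContDiffAt ℝ ∞ f x → ContDiffAt ℝ ∞ (D f) x
  congr : ∀ f g x, f =ᶠ[𝓝 x] g → D f =ᶠ[𝓝 x] D g
  add : ∀ f g x, ContDiffAt ℝ ∞ f x → ContDiffAt ℝ ∞ g x → D (f + g) =ᶠ[𝓝 x] D f + D g
  smul : ∀ (c : 𝕜) f x, ContDiffAt ℝ ∞ f x → D (c • f) =ᶠ[𝓝 x] c • D f

theorem pderiv_add_apply (j : Fin n) {f g : E n → 𝕜} {x : E n} (hf : DifferentiableAt ℝ f x)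
    (hg : DifferentiableAt ℝ g x) : pderiv j (f + g) x = pderiv j f x + pderiv j g x := by
  simp [pderiv, fderiv_add hf hg]

theorem pderiv_smul_apply (j : Fin n) (c : 𝕜) {f : E n → 𝕜} {x : E n}
    (hf : DifferentiableAt ℝ f x) : pderiv j (c • f) x = c * pderiv j f x := by
  simp [pderiv, fderiv_const_smul hf c]

theorem eventually_differentiableAt {f : E n → 𝕜} {x : E n} (hf : ContDiffAt ℝ ∞ f x) :
    ∀ᶠ y in 𝓝 x, DifferentiableAt ℝ f y := by
  have h1 : ContDiffAt ℝ 1 f x := hf.of_le (by exact_mod_cast le_top)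
  filter_upwards [h1.eventually (by simp)] with y hy
  exact hy.differentiableAt (by simp)

theorem GermLinear.pderiv (j : Fin n) : GermLinear (pderiv (𝕜 := 𝕜) j) where
  smooth f x hf := by
    have : ContDiffAt ℝ ∞ (fderiv ℝ f) x := hf.fderiv_right (by simp)
    exact this.clm_apply contDiffAt_const
  congr _ _ _ h := by
    filter_upwards [h.fderiv (𝕜 := ℝ)] with y hy
    simp [PeriodicRoumieu.pderiv, hy]
  add _ _ _ hf hg := by
    filter_upwards [eventually_differentiableAt hf, eventually_differentiableAt hg] with y h1 h2
    exact pderiv_add_apply j h1 h2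
  smul c _ _ hf := by
    filter_upwards [eventually_differentiableAt hf] with y h1
    exact pderiv_smul_apply j c h1

theorem GermLinear.id : GermLinear (fun f : E n → 𝕜 => f) :=
  ⟨fun _ _ h => h, fun _ _ _ h => h, fun _ _ _ _ _ => EventuallyEq.rfl,
    fun _ _ _ _ => EventuallyEq.rfl⟩

theorem GermLinear.comp {D D' : (E n → 𝕜) → (E n → 𝕜)} (h : GermLinear D) (h' : GermLinear D') :
    GermLinear (fun f => D (D' f)) where
  smooth _ _ hf := h.smooth _ _ (h'.smooth _ _ hf)
  congr _ _ _ e := h.congr _ _ _ (h'.congr _ _ _ e)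
  add f g x hf hg := (h.congr _ _ _ (h'.add f g x hf hg)).trans
    (h.add _ _ _ (h'.smooth _ _ hf) (h'.smooth _ _ hg))
  smul c f x hf := (h.congr _ _ _ (h'.smul c f x hf)).trans (h.smul c _ _ (h'.smooth _ _ hf))

theorem GermLinear.iterate {D : (E n → 𝕜) → (E n → 𝕜)} (h : GermLinear D) (k : ℕ) :
    GermLinear (fun f => D^[k] f) := by
  induction k with
  | zero => exact GermLinear.id
  | succ k ih => exact ih.comp h

theorem GermLinear.mderiv (β : Fin n → ℕ) : GermLinear (mderiv (𝕜 := 𝕜) β) := by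
  unfold PeriodicRoumieu.mderiv
  induction List.finRange n with
  | nil => exact GermLinear.id
  | cons j l ih => exact ((GermLinear.pderiv j).iterate (β j)).comp ih

/-- The value on `cl U` of the continuous extension of `D^β u` from `U` to `cl U`. -/
def derivExt (U : Set (E n)) (β : Fin n → ℕ) (u : closure U → 𝕜) : closure U → 𝕜 :=
  fun x => extendFrom U (mderiv β (zeroExt u)) x

/-- `D^β u` can be extended with continuity from `U` to `cl U`. -/
def HasDerivExt (U : Set (E n)) (β : Fin n → ℕ) (u : closure U → 𝕜) : Prop :=
  ∃ g : closure U → 𝕜, Continuous g ∧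
    ∀ x (hx : x ∈ U), g ⟨x, subset_closure hx⟩ = mderiv β (zeroExt u) x

theorem tendsto_of_ext {U : Set (E n)} {f : E n → 𝕜} {g : closure U → 𝕜} (hg : Continuous g)
    (h : ∀ x (hx : x ∈ U), g ⟨x, subset_closure hx⟩ = f x) (x : closure U) :
    Tendsto f (𝓝[U] (x : E n)) (𝓝 (g x)) := by
  have h1 : Tendsto (zeroExt g) (𝓝[closure U] (x : E n)) (𝓝 (g x)) := by
    rw [← map_nhds_subtype_val, tendsto_map'_iff]
    refine (hg.tendsto x).congr (fun y => ?_)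
    exact (zeroExt_apply g y.2).symm
  refine (h1.mono_left (nhdsWithin_mono _ subset_closure)).congr' ?_
  filter_upwards [self_mem_nhdsWithin] with y hy
  rw [zeroExt_apply g (subset_closure hy), h y hy]

theorem derivExt_eq {U : Set (E n)} {β : Fin n → ℕ} {u g : closure U → 𝕜} (hg : Continuous g)
    (h : ∀ x (hx : x ∈ U), g ⟨x, subset_closure hx⟩ = mderiv β (zeroExt u) x) :
    derivExt U β u = g :=
  funext fun x => extendFrom_eq x.2 (tendsto_of_ext hg h x)

/-- The space `C^∞(cl U)`, for `U` open: the functions on `cl U` that are smooth in `U` and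
whose derivatives of all orders extend continuously to `cl U` (the extension of `D^0 u` being `u`
itself). -/
def smoothSubmodule (𝕜 : Type*) [RCLike 𝕜] (U : Set (E n)) : Submodule 𝕜 (closure U → 𝕜) where
  carrier := {u | Continuous u ∧ (∀ x ∈ U, ContDiffAt ℝ ∞ (zeroExt u) x) ∧
    ∀ β, HasDerivExt U β u}
  zero_mem' := by
    have h0 : ∀ x : E n, ContDiffAt ℝ ∞ (0 : E n → 𝕜) x := fun x => contDiffAt_const
    refine ⟨continuous_const, fun x _ => ?_, fun β => ⟨0, continuous_const, fun x _ => ?_⟩⟩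
    · rw [map_zero]; exact h0 x
    · have := ((GermLinear.mderiv (𝕜 := 𝕜) β).smul 0 0 x (h0 x)).self_of_nhds
      simpa using this.symm
  add_mem' := by
    rintro u v ⟨hu, hu', hu''⟩ ⟨hv, hv', hv''⟩
    refine ⟨hu.add hv, fun x hx => ?_, fun β => ?_⟩
    · rw [map_add]; exact (hu' x hx).add (hv' x hx)
    · obtain ⟨g, hg, hg'⟩ := hu'' β
      obtain ⟨k, hk, hk'⟩ := hv'' β
      refine ⟨g + k, hg.add hk, fun x hx => ?_⟩
      rw [map_add, ((GermLinear.mderiv β).add _ _ x (hu' x hx) (hv' x hx)).self_of_nhds]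
      simp [hg' x hx, hk' x hx]
  smul_mem' := by
    rintro c u ⟨hu, hu', hu''⟩
    refine ⟨hu.const_smul c, fun x hx => ?_, fun β => ?_⟩
    · rw [map_smul]; exact (hu' x hx).const_smul c
    · obtain ⟨g, hg, hg'⟩ := hu'' β
      refine ⟨c • g, hg.const_smul c, fun x hx => ?_⟩
      rw [map_smul, ((GermLinear.mderiv β).smul c _ x (hu' x hx)).self_of_nhds]
      simp [hg' x hx]

theorem derivExt_add {U : Set (E n)} {u v : closure U → 𝕜} (hu : u ∈ smoothSubmodule 𝕜 U)
    (hv : v ∈ smoothSubmodule 𝕜 U) (β : Fin n → ℕ) :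
    derivExt U β (u + v) = derivExt U β u + derivExt U β v := by
  obtain ⟨g, hg, hg'⟩ := hu.2.2 β
  obtain ⟨k, hk, hk'⟩ := hv.2.2 β
  rw [derivExt_eq hg hg', derivExt_eq hk hk']
  refine derivExt_eq (hg.add hk) (fun x hx => ?_)
  rw [map_add, ((GermLinear.mderiv β).add _ _ x (hu.2.1 x hx) (hv.2.1 x hx)).self_of_nhds]
  simp [hg' x hx, hk' x hx]

theorem derivExt_smul {U : Set (E n)} {u : closure U → 𝕜} (hu : u ∈ smoothSubmodule 𝕜 U)
    (c : 𝕜) (β : Fin n → ℕ) : derivExt U β (c • u) = c • derivExt U β u := by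
  obtain ⟨g, hg, hg'⟩ := hu.2.2 β
  rw [derivExt_eq hg hg']
  refine derivExt_eq (hg.const_smul c) (fun x hx => ?_)
  rw [map_smul, ((GermLinear.mderiv β).smul c _ x (hu.2.1 x hx)).self_of_nhds]
  simp [hg' x hx]

/-- `sup_β (ρ^{|β|} / |β|!) ‖D^β u‖_{C⁰(K)}`, with value `∞` allowed. -/
def roumieuSup (ρ : ℝ) (U K : Set (E n)) (u : closure U → 𝕜) : ℝ≥0∞ :=
  ⨆ β : Fin n → ℕ, ENNReal.ofReal (ρ ^ (∑ j, β j) / (Nat.factorial (∑ j, β j) : ℝ)) *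
    ⨆ (x : closure U) (_ : (x : E n) ∈ K), ‖derivExt U β u x‖ₑ

theorem roumieuSup_add (ρ : ℝ) (K : Set (E n)) {U : Set (E n)} {u v : closure U → 𝕜}
    (hu : u ∈ smoothSubmodule 𝕜 U) (hv : v ∈ smoothSubmodule 𝕜 U) :
    roumieuSup ρ U K (u + v) ≤ roumieuSup ρ U K u + roumieuSup ρ U K v := by
  refine iSup_le fun β => ?_
  refine le_trans ?_ (add_le_add
    (le_iSup (fun β : Fin n → ℕ => ENNReal.ofReal (ρ ^ (∑ j, β j) / (Nat.factorial (∑ j, β j) : ℝ)) *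
      ⨆ (x : closure U) (_ : (x : E n) ∈ K), ‖derivExt U β u x‖ₑ) β)
    (le_iSup (fun β : Fin n → ℕ => ENNReal.ofReal (ρ ^ (∑ j, β j) / (Nat.factorial (∑ j, β j) : ℝ)) *
      ⨆ (x : closure U) (_ : (x : E n) ∈ K), ‖derivExt U β v x‖ₑ) β))
  rw [← mul_add]
  gcongr
  refine iSup₂_le fun x hx => ?_
  rw [derivExt_add hu hv]
  exact (enorm_add_le _ _).trans (add_le_add
    (le_iSup₂ (f := fun (x : closure U) (_ : (x : E n) ∈ K) => ‖derivExt U β u x‖ₑ) x hx)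
    (le_iSup₂ (f := fun (x : closure U) (_ : (x : E n) ∈ K) => ‖derivExt U β v x‖ₑ) x hx))

theorem roumieuSup_smul (ρ : ℝ) (K : Set (E n)) {U : Set (E n)} {u : closure U → 𝕜}
    (hu : u ∈ smoothSubmodule 𝕜 U) (c : 𝕜) :
    roumieuSup ρ U K (c • u) = ‖c‖ₑ * roumieuSup ρ U K u := by
  simp only [roumieuSup, derivExt_smul hu, ENNReal.mul_iSup, Pi.smul_apply, enorm_smul]
  simp only [mul_left_comm]

/-- The seminorm `u ↦ (p u).toReal` on a submodule where `p` is finite. -/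
def toSeminorm {V : Type*} [AddCommGroup V] [Module 𝕜 V] (M : Submodule 𝕜 V) (p : V → ℝ≥0∞)
    (hfin : ∀ u ∈ M, p u < ⊤) (hadd : ∀ u ∈ M, ∀ v ∈ M, p (u + v) ≤ p u + p v)
    (hsmul : ∀ (c : 𝕜), ∀ u ∈ M, p (c • u) = ‖c‖ₑ * p u) : Seminorm 𝕜 M :=
  Seminorm.of (fun u => (p u).toReal)
    (fun u v => ENNReal.toReal_le_add (hadd u u.2 v v.2) (hfin u u.2).ne (hfin v v.2).ne)
    (fun c u => by
      change (p (c • (u : V))).toReal = _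
      rw [hsmul c u u.2, ENNReal.toReal_mul, toReal_enorm])

/-- The vectors of `M` at which `p` is finite. -/
def finiteSubmodule {V : Type*} [AddCommGroup V] [Module 𝕜 V] (M : Submodule 𝕜 V) (p : V → ℝ≥0∞)
    (hadd : ∀ u ∈ M, ∀ v ∈ M, p (u + v) ≤ p u + p v)
    (hsmul : ∀ (c : 𝕜), ∀ u ∈ M, p (c • u) = ‖c‖ₑ * p u) : Submodule 𝕜 V where
  carrier := {u | u ∈ M ∧ p u < ⊤}
  zero_mem' := ⟨M.zero_mem, by
    have := hsmul 0 0 M.zero_mem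
    rw [zero_smul, enorm_zero, zero_mul] at this
    simp [this]⟩
  add_mem' := fun {u v} hu hv => ⟨M.add_mem hu.1 hv.1,
    (hadd u hu.1 v hv.1).trans_lt (ENNReal.add_lt_top.2 ⟨hu.2, hv.2⟩)⟩
  smul_mem' := fun c u hu => ⟨M.smul_mem c hu.1, by
    rw [hsmul c u hu.1]; exact ENNReal.mul_lt_top enorm_lt_top hu.2⟩

end Derivatives

section Spaces

variable {n : ℕ} (𝕜 : Type*) [RCLike 𝕜]

/-! ### Roumieu classes on the closure of a bounded open set -/

/-- The functions of the Roumieu class `C⁰_{ω,ρ}(cl U)`. -/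
def roumieuSubmodule (ρ : ℝ) (U : Set (E n)) : Submodule 𝕜 (closure U → 𝕜) :=
  finiteSubmodule (smoothSubmodule 𝕜 U) (roumieuSup ρ U (closure U))
    (fun _ hu _ hv => roumieuSup_add ρ _ hu hv) (fun c _ hu => roumieuSup_smul ρ _ hu c)

/-- The norm of `C⁰_{ω,ρ}(cl U)`. -/
def roumieuNorm (ρ : ℝ) (U : Set (E n)) : Seminorm 𝕜 (roumieuSubmodule 𝕜 ρ U) :=
  toSeminorm _ (roumieuSup ρ U (closure U)) (fun _ hu => hu.2)
    (fun _ hu _ hv => roumieuSup_add ρ _ hu.1 hv.1) (fun c _ hu => roumieuSup_smul ρ _ hu.1 c)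

/-- The Roumieu class `C⁰_{ω,ρ}(cl U)`, as a space normed by `roumieuNorm`. (It carries the
topology of that norm, not the one of pointwise convergence. For this and the following spaces
the `SeminormedAddCommGroup` interface is used since only the distance is needed.) -/
def Roumieu (ρ : ℝ) (U : Set (E n)) : Type _ := roumieuSubmodule 𝕜 ρ U

instance (ρ : ℝ) (U : Set (E n)) : AddCommGroup (Roumieu 𝕜 ρ U) :=
  inferInstanceAs (AddCommGroup (roumieuSubmodule 𝕜 ρ U))

instance (ρ : ℝ) (U : Set (E n)) : Module 𝕜 (Roumieu 𝕜 ρ U) :=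
  inferInstanceAs (Module 𝕜 (roumieuSubmodule 𝕜 ρ U))

instance (ρ : ℝ) (U : Set (E n)) : SeminormedAddCommGroup (Roumieu 𝕜 ρ U) :=
  AddGroupSeminorm.toSeminormedAddCommGroup (E := Roumieu 𝕜 ρ U)
    (Seminorm.toAddGroupSeminorm (E := Roumieu 𝕜 ρ U) (roumieuNorm 𝕜 ρ U))

instance (ρ : ℝ) (U : Set (E n)) : NormedSpace 𝕜 (Roumieu 𝕜 ρ U) where
  __ := (inferInstance : Module 𝕜 (Roumieu 𝕜 ρ U))
  norm_smul_le c u := (map_smul_eq_mul (roumieuNorm 𝕜 ρ U) c u).le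

/-- The function on `cl U` underlying an element of the Roumieu class. -/
def Roumieu.toFun {𝕜 : Type*} [RCLike 𝕜] {ρ : ℝ} {U : Set (E n)} (u : Roumieu 𝕜 ρ U) :
    closure U → 𝕜 := Subtype.val u

/-! ### Periodic Roumieu classes on exterior periodic sets -/

/-- The space `C^∞_q(cl S[Ω]⁻)`: smooth up to the closure, with bounded derivatives of every order,
and `q`-periodic. -/
def smoothPeriodicSubmodule (q : Fin n → ℝ) (Ω : Set (E n)) :
    Submodule 𝕜 (closure (periodicExt q Ω) → 𝕜) where
  carrier := {u | u ∈ smoothSubmodule 𝕜 (periodicExt q Ω) ∧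
    (∀ β, ∃ C : ℝ, ∀ x, ‖derivExt (periodicExt q Ω) β u x‖ ≤ C) ∧
    ∀ (j : Fin n) (x y : closure (periodicExt q Ω)),
      (y : E n) = x + EuclideanSpace.single j (q j) → u y = u x}
  zero_mem' := by
    refine ⟨Submodule.zero_mem _, fun β => ⟨0, fun x => ?_⟩, fun _ _ _ _ => rfl⟩
    have := derivExt_smul (Submodule.zero_mem (smoothSubmodule 𝕜 (periodicExt q Ω))) 0 β
    rw [zero_smul, zero_smul] at this
    simp [this]
  add_mem' := by
    rintro u v ⟨hu, hu', hu''⟩ ⟨hv, hv', hv''⟩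
    refine ⟨Submodule.add_mem _ hu hv, fun β => ?_, fun j x y h => ?_⟩
    · obtain ⟨C, hC⟩ := hu' β
      obtain ⟨C', hC'⟩ := hv' β
      refine ⟨C + C', fun x => ?_⟩
      rw [derivExt_add hu hv]
      exact (norm_add_le _ _).trans (add_le_add (hC x) (hC' x))
    · simp [hu'' j x y h, hv'' j x y h]
  smul_mem' := by
    rintro c u ⟨hu, hu', hu''⟩
    refine ⟨Submodule.smul_mem _ c hu, fun β => ?_, fun j x y h => ?_⟩
    · obtain ⟨C, hC⟩ := hu' β
      refine ⟨‖c‖ * C, fun x => ?_⟩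
      rw [derivExt_smul hu, Pi.smul_apply, norm_smul]
      exact mul_le_mul_of_nonneg_left (hC x) (norm_nonneg c)
    · simp [hu'' j x y h]

/-- The functions of the class `C⁰_{q,ω,ρ}(cl S[Ω]⁻)`; the suprema are over `cl Q ∖ Ω`
(over its points in the domain `cl S[Ω]⁻` of the functions). -/
def roumieuExtSubmodule (q : Fin n → ℝ) (ρ : ℝ) (Ω : Set (E n)) :
    Submodule 𝕜 (closure (periodicExt q Ω) → 𝕜) :=
  finiteSubmodule (smoothPeriodicSubmodule 𝕜 q Ω)
    (roumieuSup ρ (periodicExt q Ω) (closure (cell q) \ Ω))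
    (fun _ hu _ hv => roumieuSup_add ρ _ hu.1 hv.1) (fun c _ hu => roumieuSup_smul ρ _ hu.1 c)

/-- The norm of `C⁰_{q,ω,ρ}(cl S[Ω]⁻)`. -/
def roumieuExtNorm (q : Fin n → ℝ) (ρ : ℝ) (Ω : Set (E n)) :
    Seminorm 𝕜 (roumieuExtSubmodule 𝕜 q ρ Ω) :=
  toSeminorm _ (roumieuSup ρ (periodicExt q Ω) (closure (cell q) \ Ω)) (fun _ hu => hu.2)
    (fun _ hu _ hv => roumieuSup_add ρ _ hu.1.1 hv.1.1)
    (fun c _ hu => roumieuSup_smul ρ _ hu.1.1 c)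

/-- The periodic Roumieu class `C⁰_{q,ω,ρ}(cl S[Ω]⁻)`, normed by `roumieuExtNorm`. -/
def RoumieuExt (q : Fin n → ℝ) (ρ : ℝ) (Ω : Set (E n)) : Type _ := roumieuExtSubmodule 𝕜 q ρ Ω

instance (q : Fin n → ℝ) (ρ : ℝ) (Ω : Set (E n)) : AddCommGroup (RoumieuExt 𝕜 q ρ Ω) :=
  inferInstanceAs (AddCommGroup (roumieuExtSubmodule 𝕜 q ρ Ω))

instance (q : Fin n → ℝ) (ρ : ℝ) (Ω : Set (E n)) : Module 𝕜 (RoumieuExt 𝕜 q ρ Ω) :=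
  inferInstanceAs (Module 𝕜 (roumieuExtSubmodule 𝕜 q ρ Ω))

instance (q : Fin n → ℝ) (ρ : ℝ) (Ω : Set (E n)) : SeminormedAddCommGroup (RoumieuExt 𝕜 q ρ Ω) :=
  AddGroupSeminorm.toSeminormedAddCommGroup (E := RoumieuExt 𝕜 q ρ Ω)
    (Seminorm.toAddGroupSeminorm (E := RoumieuExt 𝕜 q ρ Ω) (roumieuExtNorm 𝕜 q ρ Ω))

instance (q : Fin n → ℝ) (ρ : ℝ) (Ω : Set (E n)) : NormedSpace 𝕜 (RoumieuExt 𝕜 q ρ Ω) where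
  __ := (inferInstance : Module 𝕜 (RoumieuExt 𝕜 q ρ Ω))
  norm_smul_le c u := (map_smul_eq_mul (roumieuExtNorm 𝕜 q ρ Ω) c u).le

/-- The function on `cl S[Ω]⁻` underlying an element of the periodic Roumieu class. -/
def RoumieuExt.toFun {𝕜 : Type*} [RCLike 𝕜] {q : Fin n → ℝ} {ρ : ℝ} {Ω : Set (E n)}
    (u : RoumieuExt 𝕜 q ρ Ω) : closure (periodicExt q Ω) → 𝕜 := Subtype.val u

/-! ### Weakly singular periodic kernels -/

/-- The space `C⁰_q(ℝⁿ ∖ qℤⁿ)`. -/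
def contPeriodicSubmodule (q : Fin n → ℝ) : Submodule 𝕜 (((lattice q)ᶜ : Set (E n)) → 𝕜) where
  carrier := {h | Continuous h ∧ ∀ (z : Fin n → ℤ) (x y : ((lattice q)ᶜ : Set (E n))),
    (y : E n) = x + latticePoint q z → h y = h x}
  zero_mem' := ⟨continuous_const, fun _ _ _ _ => rfl⟩
  add_mem' := fun hu hv => ⟨hu.1.add hv.1, fun z x y e => by simp [hu.2 z x y e, hv.2 z x y e]⟩
  smul_mem' := fun c _ hu => ⟨hu.1.const_smul c, fun z x y e => by simp [hu.2 z x y e]⟩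

variable {𝕜} in
/-- `sup |h(x)| |x|^lam` over the centred cell without the origin, with value `∞` allowed. -/
def kernelSup (q : Fin n → ℝ) (lam : ℝ) (h : ((lattice q)ᶜ : Set (E n)) → 𝕜) : ℝ≥0∞ :=
  ⨆ (x : ((lattice q)ᶜ : Set (E n))) (_ : (x : E n) ∈ centredCell q \ {0}),
    ‖h x‖ₑ * ENNReal.ofReal (‖(x : E n)‖ ^ lam)

variable {𝕜} in
theorem kernelSup_add (q : Fin n → ℝ) (lam : ℝ) (h k : ((lattice q)ᶜ : Set (E n)) → 𝕜) :
    kernelSup q lam (h + k) ≤ kernelSup q lam h + kernelSup q lam k := by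
  refine iSup₂_le fun x hx => ?_
  refine le_trans ?_ (add_le_add
    (le_iSup₂ (f := fun (x : ((lattice q)ᶜ : Set (E n)))
      (_ : (x : E n) ∈ centredCell q \ {0}) =>
      ‖h x‖ₑ * ENNReal.ofReal (‖(x : E n)‖ ^ lam)) x hx)
    (le_iSup₂ (f := fun (x : ((lattice q)ᶜ : Set (E n)))
      (_ : (x : E n) ∈ centredCell q \ {0}) =>
      ‖k x‖ₑ * ENNReal.ofReal (‖(x : E n)‖ ^ lam)) x hx))
  rw [← add_mul]
  gcongr
  exact enorm_add_le _ _

variable {𝕜} in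
theorem kernelSup_smul (q : Fin n → ℝ) (lam : ℝ) (c : 𝕜)
    (h : ((lattice q)ᶜ : Set (E n)) → 𝕜) :
    kernelSup q lam (c • h) = ‖c‖ₑ * kernelSup q lam h := by
  simp only [kernelSup, ENNReal.mul_iSup, Pi.smul_apply, enorm_smul, mul_assoc]

/-- The space `A⁰_{q,lam}`. -/
def kernelSubmodule₀ (q : Fin n → ℝ) (lam : ℝ) :
    Submodule 𝕜 (((lattice q)ᶜ : Set (E n)) → 𝕜) :=
  finiteSubmodule (contPeriodicSubmodule 𝕜 q) (kernelSup q lam)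
    (fun u _ v _ => kernelSup_add q lam u v) (fun c u _ => kernelSup_smul q lam c u)

variable {𝕜} in
/-- The partial derivative of a function on `ℝⁿ ∖ qℤⁿ`. -/
def kernelDeriv {q : Fin n → ℝ} (j : Fin n) (h : ((lattice q)ᶜ : Set (E n)) → 𝕜) :
    ((lattice q)ᶜ : Set (E n)) → 𝕜 :=
  fun x => pderiv j (zeroExt h) x

variable {𝕜} in
/-- Continuous differentiability on the open set `ℝⁿ ∖ qℤⁿ`. -/
def IsC1 {q : Fin n → ℝ} (h : ((lattice q)ᶜ : Set (E n)) → 𝕜) : Prop :=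
  ∀ x ∈ (lattice q)ᶜ, ContDiffAt ℝ 1 (zeroExt h) x

variable {𝕜} in
theorem kernelDeriv_add {q : Fin n → ℝ} (j : Fin n) {h k : ((lattice q)ᶜ : Set (E n)) → 𝕜}
    (hh : IsC1 h) (hk : IsC1 k) : kernelDeriv j (h + k) = kernelDeriv j h + kernelDeriv j k := by
  funext x
  simp only [kernelDeriv, map_add, Pi.add_apply]
  exact pderiv_add_apply j ((hh x x.2).differentiableAt (by simp))
    ((hk x x.2).differentiableAt (by simp))

variable {𝕜} in
theorem kernelDeriv_smul {q : Fin n → ℝ} (j : Fin n) (c : 𝕜)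
    {h : ((lattice q)ᶜ : Set (E n)) → 𝕜} (hh : IsC1 h) :
    kernelDeriv j (c • h) = c • kernelDeriv j h := by
  funext x
  simp only [kernelDeriv, map_smul, Pi.smul_apply, smul_eq_mul]
  exact pderiv_smul_apply j c ((hh x x.2).differentiableAt (by simp))

/-- The space `A¹_{q,lam}`. -/
def kernelSubmodule₁ (q : Fin n → ℝ) (lam : ℝ) :
    Submodule 𝕜 (((lattice q)ᶜ : Set (E n)) → 𝕜) where
  carrier := {h | IsC1 h ∧ h ∈ kernelSubmodule₀ 𝕜 q lam ∧
    ∀ j, kernelDeriv j h ∈ kernelSubmodule₀ 𝕜 q (lam + 1)}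
  zero_mem' := by
    have h0 : IsC1 (0 : ((lattice q)ᶜ : Set (E n)) → 𝕜) := by
      intro x _
      rw [map_zero]
      exact contDiffAt_const
    refine ⟨h0, Submodule.zero_mem _, fun j => ?_⟩
    have := kernelDeriv_smul j 0 h0
    rw [zero_smul, zero_smul] at this
    rw [this]
    exact Submodule.zero_mem _
  add_mem' := by
    rintro u v ⟨hu, hu', hu''⟩ ⟨hv, hv', hv''⟩
    refine ⟨fun x hx => ?_, Submodule.add_mem _ hu' hv', fun j => ?_⟩
    · rw [map_add]; exact (hu x hx).add (hv x hx)
    · rw [kernelDeriv_add j hu hv]; exact Submodule.add_mem _ (hu'' j) (hv'' j)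
  smul_mem' := by
    rintro c u ⟨hu, hu', hu''⟩
    refine ⟨fun x hx => ?_, Submodule.smul_mem _ c hu', fun j => ?_⟩
    · rw [map_smul]; exact (hu x hx).const_smul c
    · rw [kernelDeriv_smul j c hu]; exact Submodule.smul_mem _ c (hu'' j)

/-- Restriction to `cl G` of a function on `ℝⁿ ∖ qℤⁿ` (for `cl G ⊆ ℝⁿ ∖ qℤⁿ`). -/
def restrictTo {q : Fin n → ℝ} (G : Set (E n)) :
    (((lattice q)ᶜ : Set (E n)) → 𝕜) →ₗ[𝕜] (closure G → 𝕜) :=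
  (LinearMap.funLeft 𝕜 𝕜 (Subtype.val : closure G → E n)).comp zeroExt

/-- The functions of the kernel class `H_q^{lam,ρ}(G)`. -/
def kernelSubmodule (q : Fin n → ℝ) (lam ρ : ℝ) (G : Set (E n)) :
    Submodule 𝕜 (((lattice q)ᶜ : Set (E n)) → 𝕜) :=
  kernelSubmodule₁ 𝕜 q lam ⊓ (roumieuSubmodule 𝕜 ρ G).comap (restrictTo 𝕜 G)

/-- The norm of `A⁰_{q,lam}`. -/
def kernelNorm₀ (q : Fin n → ℝ) (lam : ℝ) : Seminorm 𝕜 (kernelSubmodule₀ 𝕜 q lam) :=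
  toSeminorm _ (kernelSup q lam) (fun _ hu => hu.2)
    (fun u _ v _ => kernelSup_add q lam u v) (fun c u _ => kernelSup_smul q lam c u)

/-- The partial derivative as a linear map from `A¹_{q,lam}` to `A⁰_{q,lam+1}`. -/
def kernelDerivₗ (q : Fin n → ℝ) (lam : ℝ) (j : Fin n) :
    kernelSubmodule₁ 𝕜 q lam →ₗ[𝕜] kernelSubmodule₀ 𝕜 q (lam + 1) where
  toFun h := ⟨kernelDeriv j h.1, h.2.2.2 j⟩
  map_add' h k := Subtype.ext (kernelDeriv_add j h.2.1 k.2.1)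
  map_smul' c h := Subtype.ext (kernelDeriv_smul j c h.2.1)

/-- The inclusion of `A¹_{q,lam}` in `A⁰_{q,lam}`. -/
def kernelIncl (q : Fin n → ℝ) (lam : ℝ) :
    kernelSubmodule₁ 𝕜 q lam →ₗ[𝕜] kernelSubmodule₀ 𝕜 q lam :=
  Submodule.inclusion (fun _ hh => hh.2.1)

/-- The norm of `A¹_{q,lam}`. -/
def kernelNorm₁ (q : Fin n → ℝ) (lam : ℝ) : Seminorm 𝕜 (kernelSubmodule₁ 𝕜 q lam) :=
  (kernelNorm₀ 𝕜 q lam).comp (kernelIncl 𝕜 q lam) +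
    ∑ j, (kernelNorm₀ 𝕜 q (lam + 1)).comp (kernelDerivₗ 𝕜 q lam j)

/-- The inclusion of `H_q^{lam,ρ}(G)` in `A¹_{q,lam}`. -/
def kernelToA₁ (q : Fin n → ℝ) (lam ρ : ℝ) (G : Set (E n)) :
    kernelSubmodule 𝕜 q lam ρ G →ₗ[𝕜] kernelSubmodule₁ 𝕜 q lam :=
  Submodule.inclusion inf_le_left

/-- The restriction to `cl G` as a linear map from `H_q^{lam,ρ}(G)` to `C⁰_{ω,ρ}(cl G)`. -/
def kernelToRoumieu (q : Fin n → ℝ) (lam ρ : ℝ) (G : Set (E n)) :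
    kernelSubmodule 𝕜 q lam ρ G →ₗ[𝕜] roumieuSubmodule 𝕜 ρ G :=
  (restrictTo 𝕜 G).restrict (fun _ hh => hh.2)

/-- The norm of `H_q^{lam,ρ}(G)`, the sum of the norm of `A¹_{q,lam}` and of the norm of the
restriction in `C⁰_{ω,ρ}(cl G)`; the latter is zero if `G` is empty. -/
def kernelNorm (q : Fin n → ℝ) (lam ρ : ℝ) (G : Set (E n)) :
    Seminorm 𝕜 (kernelSubmodule 𝕜 q lam ρ G) :=
  (kernelNorm₁ 𝕜 q lam).comp (kernelToA₁ 𝕜 q lam ρ G) +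
    (roumieuNorm 𝕜 ρ G).comp (kernelToRoumieu 𝕜 q lam ρ G)

/-- The kernel class `H_q^{lam,ρ}(G)`, normed by `kernelNorm`. -/
def Kernel (q : Fin n → ℝ) (lam ρ : ℝ) (G : Set (E n)) : Type _ := kernelSubmodule 𝕜 q lam ρ G

instance (q : Fin n → ℝ) (lam ρ : ℝ) (G : Set (E n)) : AddCommGroup (Kernel 𝕜 q lam ρ G) :=
  inferInstanceAs (AddCommGroup (kernelSubmodule 𝕜 q lam ρ G))

instance (q : Fin n → ℝ) (lam ρ : ℝ) (G : Set (E n)) : Module 𝕜 (Kernel 𝕜 q lam ρ G) :=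
  inferInstanceAs (Module 𝕜 (kernelSubmodule 𝕜 q lam ρ G))

instance (q : Fin n → ℝ) (lam ρ : ℝ) (G : Set (E n)) :
    SeminormedAddCommGroup (Kernel 𝕜 q lam ρ G) :=
  AddGroupSeminorm.toSeminormedAddCommGroup (E := Kernel 𝕜 q lam ρ G)
    (Seminorm.toAddGroupSeminorm (E := Kernel 𝕜 q lam ρ G) (kernelNorm 𝕜 q lam ρ G))

instance (q : Fin n → ℝ) (lam ρ : ℝ) (G : Set (E n)) : NormedSpace 𝕜 (Kernel 𝕜 q lam ρ G) where
  __ := (inferInstance : Module 𝕜 (Kernel 𝕜 q lam ρ G))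
  norm_smul_le c u := (map_smul_eq_mul (kernelNorm 𝕜 q lam ρ G) c u).le

/-- The function on `ℝⁿ ∖ qℤⁿ` underlying a kernel. -/
def Kernel.toFun {𝕜 : Type*} [RCLike 𝕜] {q : Fin n → ℝ} {lam ρ : ℝ} {G : Set (E n)}
    (h : Kernel 𝕜 q lam ρ G) : ((lattice q)ᶜ : Set (E n)) → 𝕜 := Subtype.val h

variable {𝕜} in
/-- The integrand `y ↦ h(x - y) φ(y)` of a volume potential; `φ` is defined on a set `s` that
contains the domain of integration, and `h(x - y)` is defined for almost every `y`. -/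
def integrand {q : Fin n → ℝ} {s : Set (E n)} (h : ((lattice q)ᶜ : Set (E n)) → 𝕜)
    (φ : s → 𝕜) (x : E n) : E n → 𝕜 :=
  fun y => zeroExt h (x - y) * zeroExt φ y

variable {𝕜} in
/-- The volume potential `P⁺[h,φ](x) = ∫_Ω h(x - y) φ(y) dy`. -/
def potentialPlus {q : Fin n → ℝ} (Ω : Set (E n)) (h : ((lattice q)ᶜ : Set (E n)) → 𝕜)
    (φ : closure Ω → 𝕜) (x : E n) : 𝕜 :=
  ∫ y in Ω, integrand h φ x y

variable {𝕜} in
/-- The volume potential `P⁻[h,φ|_{Q ∖ cl Ω}](x) = ∫_{Q ∖ cl Ω} h(x - y) φ(y) dy`, for `φ` defined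
on `cl S[Ω]⁻`, which contains `Q ∖ cl Ω` if `cl Ω ⊆ Q`. -/
def potentialMinus {q : Fin n → ℝ} (Ω : Set (E n)) (h : ((lattice q)ᶜ : Set (E n)) → 𝕜)
    (φ : closure (periodicExt q Ω) → 𝕜) (x : E n) : 𝕜 :=
  ∫ y in cell q \ closure Ω, integrand h φ x y

end Spaces

end

end PeriodicRoumieu

open PeriodicRoumieu

/-! Both potentials are convolutions over one periodicity cell of a periodic integrable kernel g,
the zero extension of h, with a periodic density f. The density is φ on one side of the periodic
boundary S = S[∂Ω] and zero on the other. So f satisfies Roumieu estimates off S and may jump across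
S, while g satisfies them on V = S[G] and is merely integrable elsewhere. The hypothesis on G and
compactness give a closed collar N of S and an open set W containing cl S[Ω₂]⁻ such that x - y lies
in V for x in W and y in N.

Take a smooth periodic cutoff θ that vanishes near S and equals 1 off N, and write f = θf + (1 -
θ)f. The second summand lives on N, so every derivative of its potential falls on g. The first
summand is smooth and periodic, so derivatives fall on it: ∂_j(g * (θ D^L f)) = g * (θ ∂_j D^L f) +
((∂_j θ) D^L f) * g (`PotentialData.pderiv_far`). Here ∂_j θ is supported in N, hence all later
derivatives of the last term are put on g. A cutoff cannot satisfy Roumieu estimates, but in this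
way it is never differentiated more than once; the terms with ∂_j θ play the part of boundary
integrals over ∂Ω.

After k derivatives there are k such terms. Each is a constant times l! m! / ρ^(l + m) with l + m =
k - 1, and l! m! ≤ (k - 1)!, so together they are at most a constant times k! ρ / ρ^k
(`PotentialData.norm_lderiv_remainder_le`). The radius ρ is thus preserved, and the constant is
linear in the norms of h and φ (`PotentialData.roumieuBound`). As W is an open neighbourhood of cl
S[Ω₂]⁻, the continuous extension of the derivatives to the boundary is automatic, and a bounded
bilinear map is continuous. -/

namespace PeriodicRoumieu

open scoped Pointwise

noncomputable section

/-! ### Iterated partial derivatives indexed by lists -/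

section IteratedDerivatives

variable {n : ℕ} {𝕜 : Type*} [RCLike 𝕜]

/-- The iterated partial derivative `∂_{j_1} ⋯ ∂_{j_m} f` along a list `[j_1, …, j_m]`. -/
def lderiv (L : List (Fin n)) (f : E n → 𝕜) : E n → 𝕜 := L.foldr pderiv f

@[simp] theorem lderiv_nil (f : E n → 𝕜) : lderiv [] f = f := rfl

@[simp] theorem lderiv_cons (j : Fin n) (L : List (Fin n)) (f : E n → 𝕜) :
    lderiv (j :: L) f = pderiv j (lderiv L f) := rfl

theorem lderiv_append (L M : List (Fin n)) (f : E n → 𝕜) :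
    lderiv (L ++ M) f = lderiv L (lderiv M f) := by
  simp [lderiv]

theorem GermLinear.lderiv (L : List (Fin n)) : GermLinear (lderiv (𝕜 := 𝕜) L) := by
  induction L with
  | nil => exact GermLinear.id
  | cons j L ih => exact (GermLinear.pderiv j).comp ih

theorem lderiv_eqOn {O : Set (E n)} (hO : IsOpen O) {f g : E n → 𝕜} (h : EqOn f g O)
    (L : List (Fin n)) : EqOn (lderiv L f) (lderiv L g) O := fun _ hx =>
  ((GermLinear.lderiv L).congr _ _ _ (h.eventuallyEq_of_mem (hO.mem_nhds hx))).self_of_nhds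

theorem lderiv_add_apply (L : List (Fin n)) {f g : E n → 𝕜} {x : E n}
    (hf : ContDiffAt ℝ ∞ f x) (hg : ContDiffAt ℝ ∞ g x) :
    lderiv L (f + g) x = lderiv L f x + lderiv L g x :=
  ((GermLinear.lderiv L).add f g x hf hg).self_of_nhds

theorem lderiv_comp_add_right (v : E n) (L : List (Fin n)) (f : E n → 𝕜) (x : E n) :
    lderiv L (fun y => f (y + v)) x = lderiv L f (x + v) := by
  induction L generalizing x with
  | nil => rfl
  | cons j L ih =>
    have : lderiv L (fun y => f (y + v)) = fun y => lderiv L f (y + v) := funext ih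
    simp only [lderiv_cons, this, pderiv, fderiv_comp_add_right]

/-- Expansion in the standard basis. It carries smoothness and bounds from the partial derivatives,
which the Roumieu norms control, to the total derivative. -/
theorem fderiv_eq_sum_pderiv (f : E n → 𝕜) (x : E n) :
    fderiv ℝ f x = ∑ j, (EuclideanSpace.proj j : E n →L[ℝ] ℝ).smulRight (pderiv j f x) := by
  ext v
  conv_lhs => rw [← (EuclideanSpace.basisFun (Fin n) ℝ).sum_repr v]
  simp [pderiv, map_sum]

theorem norm_fderiv_le_sum (f : E n → 𝕜) (x : E n) :
    ‖fderiv ℝ f x‖ ≤ ∑ j, ‖pderiv j f x‖ := by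
  rw [fderiv_eq_sum_pderiv]
  refine (norm_sum_le _ _).trans (Finset.sum_le_sum fun j _ => ?_)
  rw [ContinuousLinearMap.norm_smulRight_apply]
  refine mul_le_of_le_one_left (norm_nonneg _) ?_
  refine ContinuousLinearMap.opNorm_le_bound _ zero_le_one fun v => ?_
  simpa using PiLp.norm_apply_le v j

/-- Symmetry of the second derivative, as an equality of germs so that it can be differentiated
further. -/
theorem pderiv_comm {f : E n → 𝕜} {x : E n} (hf : ContDiffAt ℝ ∞ f x) (i j : Fin n) :
    pderiv i (pderiv j f) =ᶠ[𝓝 x] pderiv j (pderiv i f) := by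
  have h2 : ContDiffAt ℝ 2 f x := contDiffAt_infty.1 hf 2
  filter_upwards [h2.eventually (by simp)] with y hy
  have hd : DifferentiableAt ℝ (fderiv ℝ f) y :=
    (hy.fderiv_right (m := 1) (by norm_num)).differentiableAt (by simp)
  have key : ∀ i j : Fin n, pderiv i (pderiv j f) y =
      fderiv ℝ (fderiv ℝ f) y (EuclideanSpace.single i 1) (EuclideanSpace.single j 1) := by
    intro i j
    unfold pderiv
    rw [fderiv_clm_apply hd (differentiableAt_const _)]
    simp
  rw [key, key]
  exact hy.isSymmSndFDerivAt (by simp) _ _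

theorem lderiv_perm {L M : List (Fin n)} (h : L.Perm M) {f : E n → 𝕜} {x : E n}
    (hf : ContDiffAt ℝ ∞ f x) : lderiv L f =ᶠ[𝓝 x] lderiv M f := by
  induction h with
  | nil => rfl
  | cons j _ ih => exact (GermLinear.pderiv j).congr _ _ _ ih
  | swap i j L => exact pderiv_comm ((GermLinear.lderiv L).smooth _ _ hf) j i
  | trans _ _ ih ih' => exact ih.trans ih'

/-- The list in which each index `j` occurs `β j` times, in increasing order. -/
def multiIndexList (β : Fin n → ℕ) : List (Fin n) :=
  (List.finRange n).flatMap fun j => List.replicate (β j) j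

theorem mderiv_eq_lderiv (β : Fin n → ℕ) (f : E n → 𝕜) :
    mderiv β f = lderiv (multiIndexList β) f := by
  have hrep : ∀ (k : ℕ) (j : Fin n) (g : E n → 𝕜),
      (pderiv j)^[k] g = lderiv (List.replicate k j) g := by
    intro k j g
    induction k with
    | zero => rfl
    | succ k ih => rw [Function.iterate_succ_apply', ih, List.replicate_succ, lderiv_cons]
  unfold mderiv multiIndexList
  induction List.finRange n with
  | nil => rfl
  | cons j l ih => rw [List.foldr_cons, ih, List.flatMap_cons, lderiv_append, hrep]

theorem length_multiIndexList (β : Fin n → ℕ) : (multiIndexList β).length = ∑ j, β j := by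
  simp [multiIndexList, List.length_flatMap, Fin.sum_univ_def]

theorem count_multiIndexList (β : Fin n → ℕ) (i : Fin n) : (multiIndexList β).count i = β i := by
  rw [multiIndexList, List.count_flatMap]
  simp only [Function.comp_def, List.count_replicate]
  rw [← Fin.sum_univ_def]
  simp

/-- A list is a permutation of the sorted list of its multiplicities. This links the inductive
arguments, done with lists, to the norms, defined by multi-indices. -/
theorem lderiv_eq_mderiv (L : List (Fin n)) {f : E n → 𝕜} {x : E n} (hf : ContDiffAt ℝ ∞ f x) :
    lderiv L f x = mderiv (fun j => L.count j) f x := by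
  rw [mderiv_eq_lderiv]
  refine (lderiv_perm ?_ hf).self_of_nhds
  rw [List.perm_iff_count]
  intro i
  rw [count_multiIndexList]

theorem sum_count_eq_length (L : List (Fin n)) : ∑ j, L.count j = L.length := by
  rw [← length_multiIndexList]
  refine List.Perm.length_eq (List.perm_iff_count.2 fun i => ?_)
  rw [count_multiIndexList]

/-- A family of functions that are differentiable on an open set, stable under partial
derivatives, consists of smooth functions. -/
theorem contDiffOn_of_pderiv_mem {W : Set (E n)} (hW : IsOpen W) (S : Set (E n → 𝕜))
    (hd : ∀ F ∈ S, DifferentiableOn ℝ F W)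
    (hS : ∀ F ∈ S, ∀ j, ∃ F' ∈ S, EqOn (pderiv j F) F' W) {F : E n → 𝕜} (hF : F ∈ S) :
    ContDiffOn ℝ ∞ F W := by
  rw [contDiffOn_infty]
  intro m
  induction m generalizing F with
  | zero => exact contDiffOn_zero.2 (hd F hF).continuousOn
  | succ m ih =>
    push_cast
    -- The derivative is a combination of partial derivatives, which agree on `W` with members of
    -- `S`; the induction hypothesis applies to those.
    rw [contDiffOn_succ_iff_fderiv_of_isOpen hW]
    refine ⟨hd F hF, by simp, ?_⟩
    have : fderiv ℝ F = fun x =>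
        ∑ j, (EuclideanSpace.proj j : E n →L[ℝ] ℝ).smulRight (pderiv j F x) :=
      funext fun x => fderiv_eq_sum_pderiv F x
    rw [this]
    refine ContDiffOn.sum fun j _ => ?_
    obtain ⟨F', hF', he⟩ := hS F hF j
    exact contDiffOn_const.smulRight ((ih hF').congr he)

end IteratedDerivatives

/-! ### Differentiation of convolutions under the integral sign -/

section Convolution

variable {n : ℕ} {𝕜 : Type*} [RCLike 𝕜]

/-- The integral `∫ a(y) G(x - y) dμ(y)`. -/
def conv (μ : Measure (E n)) (a G : E n → 𝕜) (x : E n) : 𝕜 := ∫ y, a y * G (x - y) ∂μ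

/-- Nothing is known about `G` off `V`, but there the weight `a` vanishes, so `G` may be replaced by
its indicator on `V`. The general codomain covers both a function and its total derivative. -/
theorem aestronglyMeasurable_smul_comp_sub {F : Type*} [NormedAddCommGroup F] [NormedSpace 𝕜 F]
    {μ : Measure (E n)} {a : E n → 𝕜} {G : E n → F} {V : Set (E n)}
    (hV : IsOpen V) (hG : ContinuousOn G V) (ha : AEStronglyMeasurable a μ) {x : E n}
    (hx : ∀ y, a y ≠ 0 → x - y ∈ V) :
    AEStronglyMeasurable (fun y => a y • G (x - y)) μ := by
  have h1 : AEStronglyMeasurable (V.indicator G) (μ.map fun y => x - y) :=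
    (aestronglyMeasurable_indicator_iff hV.measurableSet).2
      (hG.aestronglyMeasurable hV.measurableSet)
  have h2 : (fun y => a y • G (x - y)) = fun y => a y • V.indicator G (x - y) := by
    funext y
    by_cases h : a y = 0
    · simp [h]
    · rw [indicator_of_mem (hx y h)]
  rw [h2]
  exact ha.smul (h1.comp_measurable (measurable_const.sub measurable_id))

theorem norm_smul_comp_sub_le {F : Type*} [NormedAddCommGroup F] [NormedSpace 𝕜 F]
    {a : E n → 𝕜} {G : E n → F} {V : Set (E n)} {C : ℝ}
    (hC : ∀ x ∈ V, ‖G x‖ ≤ C) {x : E n} (hx : ∀ y, a y ≠ 0 → x - y ∈ V) (y : E n) :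
    ‖a y • G (x - y)‖ ≤ ‖a y‖ * C := by
  rw [norm_smul]
  by_cases h : a y = 0
  · simp [h]
  · exact mul_le_mul_of_nonneg_left (hC _ (hx y h)) (norm_nonneg _)

theorem integrable_smul_comp_sub {F : Type*} [NormedAddCommGroup F] [NormedSpace 𝕜 F]
    {μ : Measure (E n)} {a : E n → 𝕜} {G : E n → F} {V : Set (E n)} {C : ℝ}
    (hV : IsOpen V) (hG : ContinuousOn G V) (hC : ∀ x ∈ V, ‖G x‖ ≤ C) (ha : Integrable a μ)
    {x : E n} (hx : ∀ y, a y ≠ 0 → x - y ∈ V) :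
    Integrable (fun y => a y • G (x - y)) μ :=
  (ha.norm.mul_const C).mono'
    (aestronglyMeasurable_smul_comp_sub hV hG ha.aestronglyMeasurable hx)
    (.of_forall (norm_smul_comp_sub_le hC hx))

theorem norm_conv_le {μ : Measure (E n)} {a G : E n → 𝕜} {V : Set (E n)} {C : ℝ}
    (hC : ∀ x ∈ V, ‖G x‖ ≤ C) (ha : Integrable a μ)
    {x : E n} (hx : ∀ y, a y ≠ 0 → x - y ∈ V) :
    ‖conv μ a G x‖ ≤ (∫ y, ‖a y‖ ∂μ) * C := by
  rw [← integral_mul_const]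
  exact norm_integral_le_of_norm_le (ha.norm.mul_const C)
    (.of_forall (norm_smul_comp_sub_le hC hx))

/-- Dominated differentiation: on `V` the total derivative of `G` is bounded by the sum of the
bounds on the partial derivatives, and `W` is a neighbourhood of `x` in which the condition on
supports persists. -/
theorem hasFDerivAt_conv {μ : Measure (E n)} {a G : E n → 𝕜} {V W : Set (E n)}
    (hV : IsOpen V) (hW : IsOpen W) (hG : ∀ x ∈ V, ContDiffAt ℝ ∞ G x)
    (hC : ∀ L, ∃ C, ∀ x ∈ V, ‖lderiv L G x‖ ≤ C) (ha : Integrable a μ)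
    (hWV : ∀ x ∈ W, ∀ y, a y ≠ 0 → x - y ∈ V) {x : E n} (hx : x ∈ W) :
    HasFDerivAt (conv μ a G) (∫ y, a y • fderiv ℝ G (x - y) ∂μ) x := by
  have hGc : ContinuousOn G V := fun x hx => (hG x hx).continuousAt.continuousWithinAt
  obtain ⟨C, hC0⟩ := hC []
  choose D hD using fun j => hC [j]
  have hfd : ∀ z ∈ V, ‖fderiv ℝ G z‖ ≤ ∑ j, D j := fun z hz =>
    (norm_fderiv_le_sum G z).trans (Finset.sum_le_sum fun j _ => hD j z hz)
  have hG'c : ContinuousOn (fderiv ℝ G) V := fun x hx =>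
    ((hG x hx).fderiv_right (m := ∞) (by simp)).continuousAt.continuousWithinAt
  refine hasFDerivAt_integral_of_dominated_of_fderiv_le (𝕜 := ℝ)
    (F := fun x y => a y * G (x - y)) (F' := fun x y => a y • fderiv ℝ G (x - y))
    (bound := fun y => ‖a y‖ * ∑ j, D j) (hW.mem_nhds hx) ?_ ?_ ?_ ?_ ?_ ?_
  · filter_upwards [hW.mem_nhds hx] with z hz
    exact aestronglyMeasurable_smul_comp_sub hV hGc ha.aestronglyMeasurable (hWV z hz)
  · exact integrable_smul_comp_sub hV hGc hC0 ha (hWV x hx)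
  · exact aestronglyMeasurable_smul_comp_sub hV hG'c ha.aestronglyMeasurable (hWV x hx)
  · exact .of_forall fun y z hz => norm_smul_comp_sub_le hfd (hWV z hz) y
  · exact ha.norm.mul_const _
  · refine .of_forall fun y z hz => ?_
    -- Where `a y = 0` the integrand is identically zero in `z`, although `G` need not be
    -- differentiable at `z - y`.
    by_cases h : a y = 0
    · have h0 : (0 : 𝕜) • fderiv ℝ G (z - y) = 0 := by ext; simp
      simpa [h, h0] using hasFDerivAt_const (0 : 𝕜) z
    · have h1 : HasFDerivAt G (fderiv ℝ G (z - y)) (z - y) :=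
        ((hG _ (hWV z hz y h)).differentiableAt (by simp)).hasFDerivAt
      have h2 : HasFDerivAt (fun z => G (z - y)) (fderiv ℝ G (z - y)) z := by
        exact h1.comp z ((hasFDerivAt_id z).sub_const y)
      exact h2.const_smul (a y)

theorem pderiv_conv {μ : Measure (E n)} {a G : E n → 𝕜} {V W : Set (E n)}
    (hV : IsOpen V) (hW : IsOpen W) (hG : ∀ x ∈ V, ContDiffAt ℝ ∞ G x)
    (hC : ∀ L, ∃ C, ∀ x ∈ V, ‖lderiv L G x‖ ≤ C) (ha : Integrable a μ)
    (hWV : ∀ x ∈ W, ∀ y, a y ≠ 0 → x - y ∈ V) (j : Fin n) {x : E n} (hx : x ∈ W) :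
    pderiv j (conv μ a G) x = conv μ a (pderiv j G) x := by
  have hG'c : ContinuousOn (fderiv ℝ G) V := fun x hx =>
    ((hG x hx).fderiv_right (m := ∞) (by simp)).continuousAt.continuousWithinAt
  choose D hD using fun j => hC [j]
  have hfd : ∀ z ∈ V, ‖fderiv ℝ G z‖ ≤ ∑ j, D j := fun z hz =>
    (norm_fderiv_le_sum G z).trans (Finset.sum_le_sum fun j _ => hD j z hz)
  rw [pderiv, (hasFDerivAt_conv hV hW hG hC ha hWV hx).fderiv]
  have hint : Integrable (fun y => a y • fderiv ℝ G (x - y)) μ :=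
    integrable_smul_comp_sub hV hG'c hfd ha (hWV x hx)
  rw [ContinuousLinearMap.integral_apply hint]
  rfl

/-- The convolutions of `a` with all the derivatives of `G` form a family of differentiable
functions stable under partial derivatives. -/
theorem contDiffOn_conv {μ : Measure (E n)} {a G : E n → 𝕜} {V W : Set (E n)}
    (hV : IsOpen V) (hW : IsOpen W) (hG : ∀ x ∈ V, ContDiffAt ℝ ∞ G x)
    (hC : ∀ L, ∃ C, ∀ x ∈ V, ‖lderiv L G x‖ ≤ C) (ha : Integrable a μ)
    (hWV : ∀ x ∈ W, ∀ y, a y ≠ 0 → x - y ∈ V) : ContDiffOn ℝ ∞ (conv μ a G) W := by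
  have hsm : ∀ L, ∀ x ∈ V, ContDiffAt ℝ ∞ (lderiv L G) x := fun L x hx =>
    (GermLinear.lderiv L).smooth _ _ (hG x hx)
  have hb : ∀ L M, ∃ C, ∀ x ∈ V, ‖lderiv M (lderiv L G) x‖ ≤ C := fun L M => by
    simpa only [← lderiv_append] using hC (M ++ L)
  refine contDiffOn_of_pderiv_mem hW (Set.range fun L => conv μ a (lderiv L G)) ?_ ?_ ⟨[], rfl⟩
  · rintro _ ⟨L, rfl⟩ x hx
    exact (hasFDerivAt_conv hV hW (hsm L) (hb L) ha hWV hx).differentiableAt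
      |>.differentiableWithinAt
  · rintro _ ⟨L, rfl⟩ j
    exact ⟨_, ⟨j :: L, rfl⟩, fun x hx => pderiv_conv hV hW (hsm L) (hb L) ha hWV j hx⟩

theorem lderiv_conv {μ : Measure (E n)} {a G : E n → 𝕜} {V W : Set (E n)}
    (hV : IsOpen V) (hW : IsOpen W) (hG : ∀ x ∈ V, ContDiffAt ℝ ∞ G x)
    (hC : ∀ L, ∃ C, ∀ x ∈ V, ‖lderiv L G x‖ ≤ C) (ha : Integrable a μ)
    (hWV : ∀ x ∈ W, ∀ y, a y ≠ 0 → x - y ∈ V) (L : List (Fin n)) :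
    EqOn (lderiv L (conv μ a G)) (conv μ a (lderiv L G)) W := by
  induction L with
  | nil => exact fun _ _ => rfl
  | cons j L ih =>
    intro x hx
    refine (lderiv_eqOn hW ih [j] hx).trans ?_
    refine pderiv_conv hV hW (fun x hx => (GermLinear.lderiv L).smooth _ _ (hG x hx))
      (fun M => ?_) ha hWV j hx
    simpa only [← lderiv_append] using hC (M ++ L)

end Convolution

/-! ### The lattice, reduction to the cell, and periodic sets -/

section Lattice

variable {n : ℕ} {q : Fin n → ℝ}

theorem latticePoint_apply (q : Fin n → ℝ) (z : Fin n → ℤ) (j : Fin n) :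
    latticePoint q z j = q j * z j := rfl

/-- `latticePoint` as an additive homomorphism. -/
def latticeHom (q : Fin n → ℝ) : (Fin n → ℤ) →+ E n where
  toFun := latticePoint q
  map_zero' := by ext j; simp [latticePoint]
  map_add' z w := by ext j; simp [latticePoint, mul_add]

theorem latticePoint_zero (q : Fin n → ℝ) : latticePoint q 0 = 0 := (latticeHom q).map_zero

theorem latticePoint_add (q : Fin n → ℝ) (z w : Fin n → ℤ) :
    latticePoint q (z + w) = latticePoint q z + latticePoint q w := (latticeHom q).map_add z w

theorem latticePoint_neg (q : Fin n → ℝ) (z : Fin n → ℤ) :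
    latticePoint q (-z) = -latticePoint q z := (latticeHom q).map_neg z

theorem isOpen_cell (q : Fin n → ℝ) : IsOpen (cell q) := by
  have : cell q = ⋂ j, {x : E n | 0 < x j ∧ x j < q j} := by ext; simp [cell]
  rw [this]
  refine isOpen_iInter_of_finite fun j => ?_
  have hc : Continuous fun x : E n => x j := by fun_prop
  exact (isOpen_lt continuous_const hc).inter (isOpen_lt hc continuous_const)

theorem mem_closure_cell (hq : ∀ j, 0 < q j) {x : E n} :
    x ∈ closure (cell q) ↔ ∀ j, 0 ≤ x j ∧ x j ≤ q j := by
  have h1 : cell q = (EuclideanSpace.equiv (Fin n) ℝ).toHomeomorph ⁻¹'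
      (Set.pi univ fun j => Ioo 0 (q j)) := by
    ext x; simp [cell]
  rw [h1, ← Homeomorph.preimage_closure, closure_pi_set]
  simp only [closure_Ioo (hq _).ne, mem_preimage, mem_univ_pi, mem_Icc]
  rfl

theorem isCompact_closure_cell (hq : ∀ j, 0 < q j) : IsCompact (closure (cell q)) := by
  have h1 : closure (cell q) = (EuclideanSpace.equiv (Fin n) ℝ).toHomeomorph ⁻¹'
      (Set.pi univ fun j => Icc 0 (q j)) := by
    ext x
    simp only [mem_closure_cell hq, mem_preimage, mem_univ_pi, mem_Icc]
    rfl
  rw [h1, Homeomorph.isCompact_preimage]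
  exact isCompact_univ_pi fun _ => isCompact_Icc

/-- The integer vector `z` such that `x` lies in the half-open cell based at `q z`. -/
def floorPart (q : Fin n → ℝ) (x : E n) : Fin n → ℤ := fun j => ⌊x j / q j⌋

/-- The representative of `x` modulo the lattice in the half-open periodicity cell. -/
def red (q : Fin n → ℝ) (x : E n) : E n := x - latticePoint q (floorPart q x)

theorem red_add (q : Fin n → ℝ) (x : E n) : red q x + latticePoint q (floorPart q x) = x :=
  sub_add_cancel _ _

theorem red_apply (hq : ∀ j, 0 < q j) (x : E n) (j : Fin n) :
    red q x j = q j * Int.fract (x j / q j) := by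
  have := (hq j).ne'
  simp only [red, PiLp.sub_apply, latticePoint_apply, floorPart, Int.fract]
  field_simp

theorem red_mem (hq : ∀ j, 0 < q j) (x : E n) : red q x ∈ closure (cell q) := by
  rw [mem_closure_cell hq]
  intro j
  rw [red_apply hq]
  exact ⟨mul_nonneg (hq j).le (Int.fract_nonneg _),
    mul_le_of_le_one_right (hq j).le (Int.fract_lt_one _).le⟩

theorem floorPart_add (hq : ∀ j, 0 < q j) (z : Fin n → ℤ) (x : E n) :
    floorPart q (x + latticePoint q z) = floorPart q x + z := by
  ext j
  have := (hq j).ne'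
  simp only [floorPart, PiLp.add_apply, latticePoint_apply, Pi.add_apply]
  rw [add_div, mul_div_cancel_left₀ _ this, Int.floor_add_intCast]

theorem red_add_latticePoint (hq : ∀ j, 0 < q j) (z : Fin n → ℤ) (x : E n) :
    red q (x + latticePoint q z) = red q x := by
  rw [red, red, floorPart_add hq, latticePoint_add]; abel

theorem red_of_mem_cell (hq : ∀ j, 0 < q j) {x : E n} (hx : x ∈ cell q) : red q x = x := by
  have : floorPart q x = 0 := by
    ext j
    simp only [floorPart, Pi.zero_apply, Int.floor_eq_zero_iff, mem_Ico]
    exact ⟨div_nonneg (hx j).1.le (hq j).le, (div_lt_one (hq j)).2 (hx j).2⟩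
  rw [red, this, latticePoint_zero, sub_zero]

/-- Periodicity with respect to the lattice `qℤⁿ`. -/
def IsLatticePeriodic {α : Type*} (q : Fin n → ℝ) (f : E n → α) : Prop :=
  ∀ z x, f (x + latticePoint q z) = f x

theorem IsLatticePeriodic.red {α : Type*} {f : E n → α} (hf : IsLatticePeriodic q f) (x : E n) :
    f (red q x) = f x := by
  conv_rhs => rw [← red_add q x, hf]

theorem isLatticePeriodic_comp_red {α : Type*} (hq : ∀ j, 0 < q j) (f : E n → α) :
    IsLatticePeriodic q (fun x => f (PeriodicRoumieu.red q x)) := fun z x => by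
  simp only [red_add_latticePoint hq]

theorem IsLatticePeriodic.const_sub {α : Type*} {f : E n → α} (hf : IsLatticePeriodic q f)
    (c : E n) : IsLatticePeriodic q (fun x => f (c - x)) := fun z x => by
  change f (c - (x + latticePoint q z)) = f (c - x)
  rw [← hf z, sub_add_eq_sub_sub, sub_add_cancel]

/-- A function invariant under the translations by `q_j e_j` is periodic. -/
theorem isLatticePeriodic_of_single {α : Type*} {f : E n → α}
    (hf : ∀ j x, f (x + EuclideanSpace.single j (q j)) = f x) : IsLatticePeriodic q f := by
  -- The periods of `f` form a subgroup, so it is enough that it contain generators of the lattice.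
  let S : AddSubgroup (E n) :=
    { carrier := {v | ∀ x, f (x + v) = f x}
      zero_mem' := fun x => by rw [add_zero]
      add_mem' := fun {v w} hv hw x => by rw [← add_assoc, hw, hv]
      neg_mem' := fun {v} hv x => by rw [← hv, neg_add_cancel_right] }
  intro z
  have h : latticePoint q z = ∑ j, z j • (EuclideanSpace.single j (q j) : E n) := by
    ext i
    simp [latticePoint_apply, mul_comm, Finset.sum_apply, Pi.single_apply]
  have : latticePoint q z ∈ S := by
    rw [h]
    exact S.sum_mem fun j _ => S.zsmul_mem (fun x => hf j x) _
  exact this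

theorem latticePoint_single (q : Fin n → ℝ) (j : Fin n) :
    latticePoint q (Pi.single j 1) = EuclideanSpace.single j (q j) := by
  ext i
  by_cases h : i = j
  · subst h; simp [latticePoint_apply]
  · simp [latticePoint_apply, h]

theorem mem_periodicSet {A : Set (E n)} {x : E n} :
    x ∈ periodicSet q A ↔ ∃ z, ∃ a ∈ A, a + latticePoint q z = x := by
  simp only [periodicSet, mem_iUnion, mem_image, add_comm]

theorem subset_periodicSet (q : Fin n → ℝ) (A : Set (E n)) : A ⊆ periodicSet q A :=
  fun a ha => mem_periodicSet.2 ⟨0, a, ha, by rw [latticePoint_zero, add_zero]⟩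

theorem periodicSet_mono {A B : Set (E n)} (h : A ⊆ B) : periodicSet q A ⊆ periodicSet q B :=
  fun _ hx => by
    obtain ⟨z, a, ha, rfl⟩ := mem_periodicSet.1 hx
    exact mem_periodicSet.2 ⟨z, a, h ha, rfl⟩

theorem add_mem_periodicSet {A : Set (E n)} {x : E n} (z : Fin n → ℤ) :
    x + latticePoint q z ∈ periodicSet q A ↔ x ∈ periodicSet q A := by
  simp only [mem_periodicSet]
  constructor
  · rintro ⟨w, a, ha, h⟩
    refine ⟨w + -z, a, ha, ?_⟩
    rw [latticePoint_add, latticePoint_neg, ← add_assoc, h, add_neg_cancel_right]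
  · rintro ⟨w, a, ha, rfl⟩
    exact ⟨w + z, a, ha, by rw [latticePoint_add, add_assoc]⟩

theorem isOpen_periodicSet {A : Set (E n)} (hA : IsOpen A) : IsOpen (periodicSet q A) :=
  isOpen_iUnion fun z => (isOpenMap_add_left (latticePoint q z)) A hA

/-- Each lattice orbit meets the open cell at most once, and there in its reduced representative. -/
theorem red_mem_iff (hq : ∀ j, 0 < q j) {A : Set (E n)} (hA : A ⊆ cell q) {x : E n} :
    red q x ∈ A ↔ x ∈ periodicSet q A := by
  constructor
  · exact fun h => mem_periodicSet.2 ⟨_, _, h, red_add q x⟩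
  · intro h
    obtain ⟨z, a, ha, rfl⟩ := mem_periodicSet.1 h
    rwa [red_add_latticePoint hq, red_of_mem_cell hq (hA ha)]

theorem mem_periodicSet_of_mem_cell (hq : ∀ j, 0 < q j) {A : Set (E n)} (hA : A ⊆ cell q) {x : E n}
    (hx : x ∈ cell q) : x ∈ periodicSet q A ↔ x ∈ A := by
  rw [← red_mem_iff hq hA, red_of_mem_cell hq hx]

theorem isClosed_lattice (hq : ∀ j, 0 < q j) : IsClosed (lattice q) := by
  have : lattice q = ⋂ j, {x : E n | x j / q j ∈ range ((↑) : ℤ → ℝ)} := by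
    ext x
    simp only [lattice, mem_range, mem_iInter, mem_ofPred_eq]
    constructor
    · rintro ⟨z, rfl⟩ j
      exact ⟨z j, by rw [latticePoint_apply, mul_div_cancel_left₀ _ (hq j).ne']⟩
    · intro h
      choose z hz using h
      refine ⟨z, ?_⟩
      ext j
      rw [latticePoint_apply, hz, mul_div_cancel₀ _ (hq j).ne']
  rw [this]
  refine isClosed_iInter fun j => ?_
  exact Int.isClosedEmbedding_coe_real.isClosed_range.preimage
    (f := fun x : E n => x j / q j) (by fun_prop)

/-- The periodic set is the sum of a compact set and the closed lattice. -/
theorem isClosed_periodicSet (hq : ∀ j, 0 < q j) {A : Set (E n)} (hA : IsCompact A) :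
    IsClosed (periodicSet q A) := by
  have : periodicSet q A = A + lattice q := by
    ext x
    simp [mem_periodicSet, Set.mem_add, lattice]
    exact exists_comm.trans (by simp)
  rw [this]
  exact (isClosed_lattice hq).add_left_of_isCompact hA

theorem closure_periodicSet (hq : ∀ j, 0 < q j) {A : Set (E n)} (hA : IsCompact (closure A)) :
    closure (periodicSet q A) = periodicSet q (closure A) := by
  refine (closure_minimal (periodicSet_mono subset_closure)
    (isClosed_periodicSet hq hA)).antisymm ?_
  intro x hx
  obtain ⟨z, a, ha, rfl⟩ := mem_periodicSet.1 hx
  refine map_mem_closure (f := fun a => a + latticePoint q z) (by fun_prop) ha ?_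
  exact fun b hb => mem_periodicSet.2 ⟨z, b, hb, rfl⟩

/-- Near a point that is congruent to a point of the open cell, `red` is a translation. -/
theorem red_eventually_eq (hq : ∀ j, 0 < q j) {x : E n} (hx : red q x ∈ cell q) :
    ∀ᶠ y in 𝓝 x, red q y = y + latticePoint q (-floorPart q x) := by
  have h1 : Tendsto (fun y => y + latticePoint q (-floorPart q x)) (𝓝 x) (𝓝 (red q x)) := by
    have : Continuous fun y => y + latticePoint q (-floorPart q x) := by fun_prop
    convert this.tendsto x using 2
    rw [red, latticePoint_neg, sub_eq_add_neg]
  filter_upwards [h1 ((isOpen_cell q).mem_nhds hx)] with y hy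
  rw [← red_add_latticePoint hq (-floorPart q x) y]
  exact red_of_mem_cell hq hy

end Lattice

/-! ### Integrals of periodic functions over a cell -/

section PeriodicIntegrals

variable {n : ℕ} {q : Fin n → ℝ}

theorem ae_apply_ne (j : Fin n) (c : ℝ) : ∀ᵐ x : E n, x j ≠ c :=
  (PiLp.volume_preserving_ofLp (Fin n)).quasiMeasurePreserving.ae
    (Measure.ae_eval_ne (fun _ => (volume : Measure ℝ)) j c)

/-- The exceptional points lie on the countably many hyperplanes `x j = q j * k`. -/
theorem ae_red_mem_cell (hq : ∀ j, 0 < q j) : ∀ᵐ x : E n, red q x ∈ cell q := by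
  have h : ∀ (j : Fin n) (k : ℤ), ∀ᵐ x : E n, x j ≠ q j * k := fun j k =>
    ae_apply_ne j _
  filter_upwards [ae_all_iff.2 fun j => ae_all_iff.2 fun k => h j k] with x hx j
  rw [red_apply hq]
  refine ⟨mul_pos (hq j) (lt_of_le_of_ne (Int.fract_nonneg _) fun h0 => ?_),
    mul_lt_of_lt_one_right (hq j) (Int.fract_lt_one _)⟩
  refine hx j ⌊x j / q j⌋ ?_
  have := Int.floor_add_fract (x j / q j)
  rw [← h0, add_zero] at this
  rw [this, mul_div_cancel₀ _ (hq j).ne']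

theorem isAddFundamentalDomain_cell (hq : ∀ j, 0 < q j) :
    IsAddFundamentalDomain (latticeHom q).range (cell q) (volume : Measure (E n)) := by
  refine IsAddFundamentalDomain.mk'' (isOpen_cell q).measurableSet.nullMeasurableSet ?_ ?_ ?_
  · filter_upwards [ae_red_mem_cell hq] with x hx
    refine ⟨⟨_, -floorPart q x, rfl⟩, ?_⟩
    change latticePoint q (-floorPart q x) + x ∈ cell q
    rwa [latticePoint_neg, neg_add_eq_sub]
  · rintro ⟨_, z, rfl⟩ hg
    refine Disjoint.aedisjoint (Set.disjoint_left.2 ?_)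
    rintro _ ⟨x, hx, rfl⟩ hx'
    refine hg (Subtype.ext ?_)
    have hx' : latticePoint q z + x ∈ cell q := hx'
    have h1 := red_add_latticePoint hq z x
    rw [red_of_mem_cell hq hx, add_comm, red_of_mem_cell hq hx'] at h1
    exact add_eq_right.1 h1
  · intro g
    exact (measurePreserving_add_left volume (g : E n)).quasiMeasurePreserving

instance countable_latticeHom_range (q : Fin n → ℝ) : Countable (latticeHom q).range :=
  (Set.countable_range (latticeHom q)).to_subtype

/-- The reflection `y ↦ c - y` preserves the measure and turns each lattice translation into its
inverse. -/
theorem isAddFundamentalDomain_preimage_sub (hq : ∀ j, 0 < q j) (c : E n) :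
    IsAddFundamentalDomain (latticeHom q).range ((fun y => c - y) ⁻¹' cell q)
      (volume : Measure (E n)) := by
  refine (isAddFundamentalDomain_cell hq).preimage_of_equiv (e := fun g => -g)
    (Measure.measurePreserving_sub_left volume c).quasiMeasurePreserving neg_bijective ?_
  rintro ⟨_, z, rfl⟩ x
  change c - (-latticePoint q z + x) = latticePoint q z + (c - x)
  abel

/-- A periodic function has the same integral over any two fundamental domains, here the cell and
its reflection. The analogue for Bochner integrals makes convolution over the cell commutative. -/
theorem setLIntegral_cell_sub (hq : ∀ j, 0 < q j) {f : E n → ℝ≥0∞} (hf : IsLatticePeriodic q f)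
    (c : E n) : ∫⁻ y in cell q, f (c - y) = ∫⁻ y in cell q, f y := by
  have h := (Measure.measurePreserving_sub_left (volume : Measure (E n)) c).setLIntegral_comp_preimage_emb
    (MeasurableEquiv.subLeft c).measurableEmbedding f (cell q)
  rw [← h]
  refine (isAddFundamentalDomain_cell hq).setLIntegral_eq
    (isAddFundamentalDomain_preimage_sub hq c) _ ?_
  rintro ⟨_, z, rfl⟩ x
  change f (c - (latticePoint q z + x)) = f (c - x)
  rw [add_comm]
  exact hf.const_sub c z x

theorem setIntegral_cell_sub {F : Type*} [NormedAddCommGroup F] [NormedSpace ℝ F]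
    (hq : ∀ j, 0 < q j) {f : E n → F} (hf : IsLatticePeriodic q f)
    (c : E n) : ∫ y in cell q, f (c - y) = ∫ y in cell q, f y := by
  have h := (Measure.measurePreserving_sub_left (volume : Measure (E n)) c).setIntegral_preimage_emb
    (MeasurableEquiv.subLeft c).measurableEmbedding f (cell q)
  rw [← h]
  refine (isAddFundamentalDomain_cell hq).setIntegral_eq
    (isAddFundamentalDomain_preimage_sub hq c) ?_
  rintro ⟨_, z, rfl⟩ x
  change f (c - (latticePoint q z + x)) = f (c - x)
  rw [add_comm]
  exact hf.const_sub c z x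

theorem integrableOn_cell_sub {𝕜 : Type*} [RCLike 𝕜] (hq : ∀ j, 0 < q j) {f : E n → 𝕜}
    (hf : IsLatticePeriodic q f) (hm : AEStronglyMeasurable f) (hi : IntegrableOn f (cell q))
    (c : E n) : IntegrableOn (fun y => f (c - y)) (cell q) := by
  refine ⟨(hm.comp_quasiMeasurePreserving
    (Measure.measurePreserving_sub_left volume c).quasiMeasurePreserving).restrict, ?_⟩
  have h2 := hi.hasFiniteIntegral
  rw [hasFiniteIntegral_iff_enorm] at h2 ⊢
  rwa [setLIntegral_cell_sub hq (f := fun y => ‖f y‖ₑ) (fun z x => congrArg _ (hf z x)) c]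

end PeriodicIntegrals

/-! ### Roumieu estimates for the potential of a periodic density -/

section Estimate

variable {n : ℕ} {𝕜 : Type*} [RCLike 𝕜]

/-- The function `f` is smooth at the points of `O`, with Roumieu estimates of radius `ρ` and
constant `B`. -/
structure RoumieuBound (ρ B : ℝ) (O : Set (E n)) (f : E n → 𝕜) : Prop where
  smooth : ∀ x ∈ O, ContDiffAt ℝ ∞ f x
  bound : ∀ (L : List (Fin n)), ∀ x ∈ O,
    ‖lderiv L f x‖ ≤ B * ((Nat.factorial L.length : ℝ) / ρ ^ L.length)

/-- A smooth periodic function with values in the unit disc that vanishes near `S` and equals `1`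
outside of `N`, and whose partial derivatives are bounded by `c`. -/
structure IsCutoff (q : Fin n → ℝ) (S N : Set (E n)) (c : ℝ) (θ : E n → 𝕜) : Prop where
  smooth : ContDiff ℝ ∞ θ
  periodic : IsLatticePeriodic q θ
  zero : ∀ x ∈ S, θ =ᶠ[𝓝 x] 0
  one : ∀ x ∉ N, θ x = 1
  norm_le : ∀ x, ‖θ x‖ ≤ 1
  norm_one_sub_le : ∀ x, ‖1 - θ x‖ ≤ 1
  norm_pderiv_le : ∀ j x, ‖pderiv j θ x‖ ≤ c

theorem lderiv_zero (L : List (Fin n)) : lderiv L (0 : E n → 𝕜) = 0 := by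
  induction L with
  | nil => rfl
  | cons j L ih =>
    rw [lderiv_cons, ih]
    funext x
    simp [pderiv]

theorem IsLatticePeriodic.lderiv {q : Fin n → ℝ} {f : E n → 𝕜} (hf : IsLatticePeriodic q f)
    (L : List (Fin n)) : IsLatticePeriodic q (lderiv L f) := fun z x => by
  rw [← lderiv_comp_add_right]
  congr 1
  exact funext fun y => hf z y

theorem IsLatticePeriodic.exists_bound {q : Fin n → ℝ} (hq : ∀ j, 0 < q j) {f : E n → 𝕜}
    (hf : IsLatticePeriodic q f) (hc : Continuous f) : ∃ C, ∀ x, ‖f x‖ ≤ C := by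
  obtain ⟨C, hC⟩ := (isCompact_closure_cell hq).exists_bound_of_continuousOn hc.continuousOn
  exact ⟨C, fun x => by rw [← hf.red]; exact hC _ (red_mem hq x)⟩

theorem contDiff_lderiv {f : E n → 𝕜} (hf : ContDiff ℝ ∞ f) (L : List (Fin n)) :
    ContDiff ℝ ∞ (lderiv L f) :=
  contDiff_iff_contDiffAt.2 fun _ => (GermLinear.lderiv L).smooth _ _ hf.contDiffAt

theorem contDiff_mul_of_vanishing {S : Set (E n)} {χ u : E n → 𝕜} (hχ : ContDiff ℝ ∞ χ)
    (h0 : ∀ x ∈ S, χ =ᶠ[𝓝 x] 0) (hu : ∀ x ∉ S, ContDiffAt ℝ ∞ u x) :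
    ContDiff ℝ ∞ (fun x => χ x * u x) := by
  refine contDiff_iff_contDiffAt.2 fun x => ?_
  by_cases hx : x ∈ S
  · refine (contDiffAt_const (c := (0 : 𝕜))).congr_of_eventuallyEq ?_
    filter_upwards [h0 x hx] with y hy
    simp [hy]
  · exact hχ.contDiffAt.mul (hu x hx)

theorem measure_cell_lt_top {q : Fin n → ℝ} (hq : ∀ j, 0 < q j) : volume (cell q) < ⊤ :=
  (measure_mono subset_closure).trans_lt (isCompact_closure_cell hq).measure_lt_top

theorem integrable_of_bounded_cell {q : Fin n → ℝ} (hq : ∀ j, 0 < q j) {w : E n → 𝕜} {b : ℝ}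
    (hm : AEStronglyMeasurable w (volume.restrict (cell q))) (hb : ∀ x, ‖w x‖ ≤ b) :
    Integrable w (volume.restrict (cell q)) := by
  have : IsFiniteMeasure (volume.restrict (cell q) : Measure (E n)) :=
    ⟨by simpa using measure_cell_lt_top hq⟩
  exact Integrable.of_bound hm b (.of_forall hb)

theorem integral_norm_cell_le {q : Fin n → ℝ} (hq : ∀ j, 0 < q j) {w : E n → 𝕜} {b : ℝ}
    (hb : ∀ x, ‖w x‖ ≤ b) : ∫ x in cell q, ‖w x‖ ≤ b * volume.real (cell q) := by
  refine (le_abs_self _).trans ?_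
  exact norm_setIntegral_le_of_norm_le_const (f := fun x => ‖w x‖) (measure_cell_lt_top hq)
    fun x _ => by simpa using hb x

/-- Roumieu estimates for `∫ w(y) g(x - y) dy` if all the derivatives can be put on `g`. -/
theorem roumieuBound_conv {q : Fin n → ℝ} (hq : ∀ j, 0 < q j) {ρ A b : ℝ} (hρ : 0 < ρ) (hA : 0 ≤ A)
    {V W N : Set (E n)} (hV : IsOpen V) (hW : IsOpen W) (hWV : ∀ x ∈ W, ∀ y ∈ N, x - y ∈ V)
    {g w : E n → 𝕜} (hg : RoumieuBound ρ A V g)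
    (hm : AEStronglyMeasurable w (volume.restrict (cell q)))
    (hb : ∀ x, ‖w x‖ ≤ b) (hwN : ∀ x ∉ N, w x = 0) :
    RoumieuBound ρ (b * volume.real (cell q) * A) W (conv (volume.restrict (cell q)) w g) := by
  have hi := integrable_of_bounded_cell hq hm hb
  have hsupp : ∀ x ∈ W, ∀ y, w y ≠ 0 → x - y ∈ V := fun x hx y hy =>
    hWV x hx y (by by_contra h; exact hy (hwN y h))
  have hC : ∀ L, ∃ C, ∀ x ∈ V, ‖lderiv L g x‖ ≤ C := fun L => ⟨_, hg.bound L⟩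
  refine ⟨fun x hx => (contDiffOn_conv hV hW hg.smooth hC hi hsupp).contDiffAt (hW.mem_nhds hx),
    fun L x hx => ?_⟩
  rw [lderiv_conv hV hW hg.smooth hC hi hsupp L hx, mul_assoc]
  refine (norm_conv_le (hg.bound L) hi (hsupp x hx)).trans ?_
  gcongr
  exact integral_norm_cell_le hq hb

theorem RoumieuBound.add {ρ A B : ℝ} {O : Set (E n)} {f g : E n → 𝕜} (hf : RoumieuBound ρ A O f)
    (hg : RoumieuBound ρ B O g) : RoumieuBound ρ (A + B) O (f + g) where
  smooth x hx := (hf.smooth x hx).add (hg.smooth x hx)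
  bound L x hx := by
    rw [lderiv_add_apply L (hf.smooth x hx) (hg.smooth x hx), add_mul]
    exact (norm_add_le _ _).trans (add_le_add (hf.bound L x hx) (hg.bound L x hx))

theorem RoumieuBound.congr {ρ A : ℝ} {O : Set (E n)} (hO : IsOpen O) {f g : E n → 𝕜}
    (hf : RoumieuBound ρ A O f) (h : EqOn g f O) : RoumieuBound ρ A O g where
  smooth x hx := (hf.smooth x hx).congr_of_eventuallyEq (h.eventuallyEq_of_mem (hO.mem_nhds hx))
  bound L x hx := by
    rw [lderiv_eqOn hO h L hx]
    exact hf.bound L x hx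

theorem RoumieuBound.mono {ρ A B : ℝ} {O : Set (E n)} (hρ : 0 < ρ) {f : E n → 𝕜}
    (hf : RoumieuBound ρ A O f) (h : A ≤ B) : RoumieuBound ρ B O f where
  smooth := hf.smooth
  bound L x hx := (hf.bound L x hx).trans (by gcongr)

variable {q : Fin n → ℝ} {ρ A B c : ℝ} {S N V W : Set (E n)} {f g θ : E n → 𝕜}

theorem IsCutoff.pderiv_eventually_zero (hθ : IsCutoff q S N c θ) (j : Fin n) {x : E n}
    (hx : x ∈ S) : pderiv j θ =ᶠ[𝓝 x] 0 := by
  have h := (GermLinear.pderiv j).congr _ _ _ (hθ.zero x hx)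
  have h0 : pderiv j (0 : E n → 𝕜) = 0 := lderiv_zero [j]
  rwa [h0] at h

theorem IsCutoff.pderiv_eq_zero (hθ : IsCutoff q S N c θ) (hN : IsClosed N) (j : Fin n) {x : E n}
    (hx : x ∉ N) : pderiv j θ x = 0 := by
  have h : θ =ᶠ[𝓝 x] fun _ => 1 := by
    filter_upwards [hN.isOpen_compl.mem_nhds hx] with y hy using hθ.one y hy
  rw [pderiv, h.fderiv_eq]
  simp

/-- The functions obtained by differentiating the density are smooth after multiplication by the
cutoff. -/
theorem IsCutoff.contDiff_mul (hθ : IsCutoff q S N c θ) (hf : RoumieuBound ρ B Sᶜ f)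
    (L : List (Fin n)) : ContDiff ℝ ∞ (fun x => θ x * lderiv L f x) :=
  contDiff_mul_of_vanishing hθ.smooth hθ.zero fun x hx =>
    (GermLinear.lderiv L).smooth _ _ (hf.smooth x hx)

theorem IsCutoff.contDiff_pderiv_mul (hθ : IsCutoff q S N c θ) (hf : RoumieuBound ρ B Sᶜ f)
    (j : Fin n) (L : List (Fin n)) : ContDiff ℝ ∞ (fun x => pderiv j θ x * lderiv L f x) :=
  contDiff_mul_of_vanishing (contDiff_lderiv hθ.smooth [j])
    (fun _ hx => hθ.pderiv_eventually_zero j hx)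
    fun x hx => (GermLinear.lderiv L).smooth _ _ (hf.smooth x hx)

/-- The product rule also holds at points of `S`, where `f` may be discontinuous: `θ` vanishes near
them, and both sides are zero. -/
theorem IsCutoff.pderiv_mul (hθ : IsCutoff q S N c θ) (hf : RoumieuBound ρ B Sᶜ f)
    (j : Fin n) (L : List (Fin n)) (x : E n) :
    pderiv j (fun x => θ x * lderiv L f x) x =
      θ x * lderiv (j :: L) f x + pderiv j θ x * lderiv L f x := by
  by_cases hx : x ∈ S
  · have h : (fun x => θ x * lderiv L f x) =ᶠ[𝓝 x] 0 := by
      filter_upwards [hθ.zero x hx] with y hy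
      simp [hy]
    have h1 := ((GermLinear.pderiv j).congr _ _ _ h).self_of_nhds
    have h0 : pderiv j (0 : E n → 𝕜) = 0 := lderiv_zero [j]
    rw [h1, h0, (hθ.zero x hx).self_of_nhds, (hθ.pderiv_eventually_zero j hx).self_of_nhds]
    simp
  · have h1 : DifferentiableAt ℝ θ x := hθ.smooth.contDiffAt.differentiableAt (by simp)
    have h2 : DifferentiableAt ℝ (lderiv L f) x :=
      ((GermLinear.lderiv L).smooth _ _ (hf.smooth x hx)).differentiableAt (by simp)
    rw [pderiv, fderiv_fun_mul h1 h2]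
    simp [pderiv, mul_comm]

/-- The substitution `y ↦ x - y` does not change the cell integral of a periodic function. It
decides which factor receives the next derivative. -/
theorem conv_cell_comm (hq : ∀ j, 0 < q j) {g ψ : E n → 𝕜} (hg : IsLatticePeriodic q g)
    (hψ : IsLatticePeriodic q ψ) (x : E n) :
    conv (volume.restrict (cell q)) g ψ x = conv (volume.restrict (cell q)) ψ g x := by
  have h := setIntegral_cell_sub hq (f := fun y => g y * ψ (x - y)) (fun z y => by
    change g (y + latticePoint q z) * ψ (x - (y + latticePoint q z)) = _
    rw [hg]
    exact congrArg _ (hψ.const_sub x z y)) x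
  simp only [conv, ← h, sub_sub_cancel, mul_comm]

/-- The data of the potential estimate: a periodic integrable kernel `g` with Roumieu estimates
on `V`, a periodic density `f` with Roumieu estimates off the closed set `S`, a cutoff `θ`. -/
structure PotentialData (q : Fin n → ℝ) (ρ A B c : ℝ) (S N V W : Set (E n)) (g f θ : E n → 𝕜) :
    Prop where
  hq : ∀ j, 0 < q j
  hρ : 0 < ρ
  hc : 0 ≤ c
  hA : 0 ≤ A
  hB : 0 ≤ B
  isClosed_S : IsClosed S
  isClosed_N : IsClosed N
  isOpen_V : IsOpen V
  isOpen_W : IsOpen W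
  sub_mem : ∀ x ∈ W, ∀ y ∈ N, x - y ∈ V
  g_periodic : IsLatticePeriodic q g
  g_meas : AEStronglyMeasurable g
  g_int : IntegrableOn g (cell q)
  g_norm : ∫ y in cell q, ‖g y‖ ≤ A
  g_bound : RoumieuBound ρ A V g
  f_periodic : IsLatticePeriodic q f
  f_zero : ∀ x ∈ S, f x = 0
  f_bound : RoumieuBound ρ B Sᶜ f
  cutoff : IsCutoff q S N c θ

variable (D : PotentialData q ρ A B c S N V W g f θ)
include D

/-- Smooth periodic functions are bounded. These bounds only justify differentiation under the
integral and do not enter the final constant. -/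
theorem PotentialData.exists_bound (L M : List (Fin n)) :
    ∃ C, ∀ x ∈ (univ : Set (E n)), ‖lderiv M (fun x => θ x * lderiv L f x) x‖ ≤ C := by
  have hp : IsLatticePeriodic q (fun x => θ x * lderiv L f x) := fun z x => by
    simp only [D.cutoff.periodic z x, D.f_periodic.lderiv L z x]
  obtain ⟨C, hC⟩ := (hp.lderiv M).exists_bound D.hq
    (contDiff_lderiv (D.cutoff.contDiff_mul D.f_bound L) M).continuous
  exact ⟨C, fun x _ => hC x⟩

theorem PotentialData.contDiff_far (L : List (Fin n)) :
    ContDiff ℝ ∞ (conv (volume.restrict (cell q)) g fun x => θ x * lderiv L f x) :=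
  contDiffOn_univ.1 (contDiffOn_conv isOpen_univ isOpen_univ
    (fun _ _ => (D.cutoff.contDiff_mul D.f_bound L).contDiffAt) (D.exists_bound L) D.g_int
    fun _ _ _ _ => mem_univ _)

/-- The derivative is put on the smooth factor and expanded by the product rule. The term with the
derivative of `θ` is then commuted, so that further derivatives of it can fall on `g`. -/
theorem PotentialData.pderiv_far (j : Fin n) (L : List (Fin n)) (x : E n) :
    pderiv j (conv (volume.restrict (cell q)) g fun x => θ x * lderiv L f x) x =
      conv (volume.restrict (cell q)) g (fun x => θ x * lderiv (j :: L) f x) x +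
        conv (volume.restrict (cell q)) (fun x => pderiv j θ x * lderiv L f x) g x := by
  have hp1 : IsLatticePeriodic q (fun x => pderiv j θ x * lderiv L f x) := fun z x => by
    simp only [D.f_periodic.lderiv L z x]
    congr 1
    exact D.cutoff.periodic.lderiv [j] z x
  rw [pderiv_conv isOpen_univ isOpen_univ
    (fun _ _ => (D.cutoff.contDiff_mul D.f_bound L).contDiffAt) (D.exists_bound L) D.g_int
    (fun _ _ _ _ => mem_univ _) j (mem_univ x)]
  have he : pderiv j (fun x => θ x * lderiv L f x) = fun x =>
      θ x * lderiv (j :: L) f x + pderiv j θ x * lderiv L f x :=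
    funext (D.cutoff.pderiv_mul D.f_bound j L)
  rw [← conv_cell_comm D.hq D.g_periodic hp1, he]
  simp only [conv, mul_add]
  obtain ⟨C, hC⟩ := D.exists_bound (j :: L) []
  obtain ⟨C', hC'⟩ := hp1.exists_bound D.hq
    (D.cutoff.contDiff_pderiv_mul D.f_bound j L).continuous
  refine integral_add ?_ ?_
  · exact integrable_smul_comp_sub isOpen_univ
      (D.cutoff.contDiff_mul D.f_bound (j :: L)).continuous.continuousOn hC D.g_int
      fun _ _ => mem_univ _
  · exact integrable_smul_comp_sub isOpen_univ
      (D.cutoff.contDiff_pderiv_mul D.f_bound j L).continuous.continuousOn (fun x _ => hC' x)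
      D.g_int fun _ _ => mem_univ _

/-- The density is supported in the collar `N`, where differences with points of `W` stay in `V`.
Its supremum involves one derivative of `θ` only, bounded by `c`, and the estimate of order
`L.length` on `f`. -/
theorem PotentialData.roumieuBound_boundary (j : Fin n) (L : List (Fin n)) :
    RoumieuBound ρ (c * (B * ((Nat.factorial L.length : ℝ) / ρ ^ L.length)) *
      volume.real (cell q) * A) W
      (conv (volume.restrict (cell q)) (fun x => pderiv j θ x * lderiv L f x) g) := by
  have hρ := D.hρ
  have hc := D.hc
  have hB := D.hB
  refine roumieuBound_conv D.hq D.hρ D.hA D.isOpen_V D.isOpen_W D.sub_mem D.g_bound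
    (D.cutoff.contDiff_pderiv_mul D.f_bound j L).continuous.aestronglyMeasurable
    (fun x => ?_) fun x hx => ?_
  · by_cases hx : x ∈ S
    · rw [(D.cutoff.pderiv_eventually_zero j hx).self_of_nhds]
      simp only [Pi.zero_apply, zero_mul, norm_zero]
      positivity
    · rw [norm_mul]
      exact mul_le_mul (D.cutoff.norm_pderiv_le j x) (D.f_bound.bound L x hx) (norm_nonneg _) hc
  · rw [D.cutoff.pderiv_eq_zero D.isClosed_N j hx, zero_mul]

/-- Let `R_L` be the difference. Then `R_{j :: L}` is `∂_j R_L` plus one collar term, so `R_L` is a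
sum of `L.length` differentiated collar terms. The outer list `M` absorbs `∂_j` in the induction.
For empty `L` the truncated subtraction is harmless, as the factor `L.length` is zero. -/
theorem PotentialData.norm_lderiv_remainder_le (L M : List (Fin n)) {x : E n} (hx : x ∈ W) :
    ‖lderiv M (lderiv L (conv (volume.restrict (cell q)) g fun x => θ x * f x) -
        conv (volume.restrict (cell q)) g fun x => θ x * lderiv L f x) x‖ ≤
      (L.length * Nat.factorial (M.length + L.length - 1) : ℕ) *
        (c * B * volume.real (cell q) * A) * (ρ / ρ ^ (M.length + L.length)) := by
  have hρ := D.hρ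
  have hc := D.hc
  have hB := D.hB
  have hA := D.hA
  induction L generalizing M x with
  | nil =>
    simp only [lderiv_nil, sub_self, lderiv_zero]
    simp
  | cons j L ih =>
    set Y := conv (volume.restrict (cell q)) g fun x => θ x * f x with hY
    have hYs : ContDiff ℝ ∞ Y := D.contDiff_far []
    set R := lderiv L Y - conv (volume.restrict (cell q)) g fun x => θ x * lderiv L f x with hR
    have hRs : ContDiff ℝ ∞ R := (contDiff_lderiv hYs L).sub (D.contDiff_far L)
    have hstep : lderiv (j :: L) Y -
        (conv (volume.restrict (cell q)) g fun x => θ x * lderiv (j :: L) f x) =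
        pderiv j R + conv (volume.restrict (cell q)) (fun x => pderiv j θ x * lderiv L f x) g := by
      funext y
      have h1 : pderiv j R y = pderiv j (lderiv L Y) y -
          pderiv j (conv (volume.restrict (cell q)) g fun x => θ x * lderiv L f x) y := by
        rw [hR, pderiv, fderiv_sub]
        · rfl
        · exact (contDiff_lderiv hYs L).differentiable (by simp) y
        · exact (D.contDiff_far L).differentiable (by simp) y
      rw [Pi.add_apply, h1, D.pderiv_far]
      simp only [Pi.sub_apply, lderiv_cons]
      ring
    have hT := D.roumieuBound_boundary j L
    have hRj : ContDiff ℝ ∞ (pderiv j R) := contDiff_lderiv hRs [j]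
    rw [hstep, lderiv_add_apply M hRj.contDiffAt (hT.smooth x hx)]
    refine (norm_add_le _ _).trans ?_
    have e1 : lderiv M (pderiv j R) x = lderiv (M ++ [j]) R x := by
      rw [lderiv_append]; rfl
    rw [e1]
    refine (add_le_add (ih (M ++ [j]) hx) (hT.bound M x hx)).trans ?_
    simp only [List.length_append, List.length_cons, List.length_nil, zero_add]
    set m := M.length
    set l := L.length
    have e2 : m + 1 + l - 1 = m + l := by omega
    have e3 : m + (l + 1) - 1 = m + l := by omega
    have e4 : m + 1 + l = m + l + 1 := by omega
    have e5 : ρ / ρ ^ (m + l + 1) = 1 / ρ ^ (m + l) := by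
      rw [pow_succ]; field_simp
    rw [e2, e3, e4, ← add_assoc, e5]
    -- The `l` derivatives on `f` and the `m` derivatives on `g` contribute a product of factorials;
    -- this inequality keeps the radius `ρ` unchanged.
    have hfac : ((Nat.factorial l : ℝ) * Nat.factorial m) ≤ Nat.factorial (m + l) := by
      rw [mul_comm]
      exact_mod_cast Nat.factorial_mul_factorial_dvd_factorial_add m l
        |> Nat.le_of_dvd (Nat.factorial_pos _)
    calc _ = (l * Nat.factorial (m + l) + (Nat.factorial l : ℝ) * Nat.factorial m) *
          (c * B * volume.real (cell q) * A) * (1 / ρ ^ (m + l)) := by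
            rw [pow_add]; push_cast; field_simp
      _ ≤ (l * Nat.factorial (m + l) + Nat.factorial (m + l)) *
          (c * B * volume.real (cell q) * A) * (1 / ρ ^ (m + l)) := by gcongr
      _ = _ := by push_cast; ring

/-- The main term `g * (θ D^L f)` is bounded by the integral of `|g|` times the estimate on `f`; the
remainder is the previous bound with `M` empty. -/
theorem PotentialData.roumieuBound_far :
    RoumieuBound ρ ((1 + c * volume.real (cell q) * ρ) * A * B) W
      (conv (volume.restrict (cell q)) g fun x => θ x * f x) := by
  have hρ := D.hρ
  have hc := D.hc
  have hB := D.hB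
  have hA := D.hA
  refine ⟨fun x _ => (D.contDiff_far []).contDiffAt, fun L x hx => ?_⟩
  have h1 := D.norm_lderiv_remainder_le L [] hx
  simp only [lderiv_nil, List.length_nil, zero_add, Pi.sub_apply] at h1
  have h2 : ‖conv (volume.restrict (cell q)) g (fun x => θ x * lderiv L f x) x‖ ≤
      A * (B * ((Nat.factorial L.length : ℝ) / ρ ^ L.length)) := by
    refine (norm_conv_le (V := univ) (fun y _ => ?_) D.g_int fun _ _ => mem_univ _).trans
      (mul_le_mul_of_nonneg_right D.g_norm (by positivity))
    by_cases hy : y ∈ S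
    · rw [(D.cutoff.zero y hy).self_of_nhds]
      simp only [Pi.zero_apply, zero_mul, norm_zero]
      positivity
    · rw [norm_mul]
      exact (mul_le_mul (D.cutoff.norm_le y) (D.f_bound.bound L y hy) (norm_nonneg _)
        zero_le_one).trans (one_mul _).le
  have h3 : ((L.length * Nat.factorial (L.length - 1) : ℕ) : ℝ) ≤ Nat.factorial L.length := by
    rcases Nat.eq_zero_or_pos L.length with h | h
    · simp [h]
    · rw [Nat.mul_factorial_pred h.ne']
  refine (norm_le_norm_add_norm_sub' _
    (conv (volume.restrict (cell q)) g (fun x => θ x * lderiv L f x) x)).trans ?_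
  refine (add_le_add h2 h1).trans ?_
  calc _ ≤ A * (B * ((Nat.factorial L.length : ℝ) / ρ ^ L.length)) + Nat.factorial L.length *
        (c * B * volume.real (cell q) * A) * (ρ / ρ ^ L.length) := by gcongr
    _ = _ := by ring

theorem PotentialData.aestronglyMeasurable_f : AEStronglyMeasurable f := by
  have h : f = Sᶜ.indicator f := by
    refine (indicator_eq_self.2 fun x hx hS => hx (D.f_zero x hS)).symm
  rw [h, aestronglyMeasurable_indicator_iff D.isClosed_S.isOpen_compl.measurableSet]
  exact ContinuousOn.aestronglyMeasurable
    (fun x hx => (D.f_bound.smooth x hx).continuousAt.continuousWithinAt)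
    D.isClosed_S.isOpen_compl.measurableSet

theorem PotentialData.norm_f_le (x : E n) : ‖f x‖ ≤ B := by
  by_cases hx : x ∈ S
  · rw [D.f_zero x hx, norm_zero]; exact D.hB
  · simpa using D.f_bound.bound [] x hx

theorem PotentialData.integrable (x : E n) :
    IntegrableOn (fun y => g (x - y) * f y) (cell q) :=
  (integrableOn_cell_sub D.hq D.g_periodic D.g_meas D.g_int x).mul_bdd (c := B)
    D.aestronglyMeasurable_f.restrict (.of_forall D.norm_f_le)

/-- Roumieu estimates for a periodic volume potential. -/
theorem PotentialData.roumieuBound :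
    RoumieuBound ρ ((1 + c * volume.real (cell q) * ρ + volume.real (cell q)) * A * B) W
      (fun x => ∫ y in cell q, g (x - y) * f y) := by
  have hmθ : AEStronglyMeasurable (fun y => (1 - θ y) * f y) :=
    (continuous_const.sub D.cutoff.smooth.continuous).aestronglyMeasurable.mul
      D.aestronglyMeasurable_f
  have hb : ∀ y, ‖(1 - θ y) * f y‖ ≤ B := fun y => by
    rw [norm_mul]
    exact (mul_le_mul (D.cutoff.norm_one_sub_le y) (D.norm_f_le y) (norm_nonneg _)
      zero_le_one).trans (one_mul _).le
  -- The complementary density `(1 - θ) f` vanishes off the collar, so all derivatives go to the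
  -- kernel.
  have hnear := roumieuBound_conv D.hq D.hρ D.hA D.isOpen_V D.isOpen_W D.sub_mem D.g_bound
    hmθ.restrict hb (fun y hy => by rw [D.cutoff.one y hy, sub_self, zero_mul])
  refine ((D.roumieuBound_far.add hnear).congr D.isOpen_W fun x _ => ?_).mono D.hρ (by
    apply le_of_eq; ring)
  have hp : IsLatticePeriodic q (fun x => θ x * f x) := fun z x => by
    simp only [D.cutoff.periodic z x, D.f_periodic z x]
  rw [Pi.add_apply, conv_cell_comm D.hq D.g_periodic hp]
  have hgx := integrableOn_cell_sub D.hq D.g_periodic D.g_meas D.g_int x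
  simp only [conv]
  rw [← integral_add]
  · congr 1
    funext y
    ring
  · refine hgx.bdd_mul (c := B)
      (D.cutoff.smooth.continuous.aestronglyMeasurable.mul D.aestronglyMeasurable_f).restrict
      (.of_forall fun y => ?_)
    rw [norm_mul]
    exact (mul_le_mul (D.cutoff.norm_le y) (D.norm_f_le y) (norm_nonneg _)
      zero_le_one).trans (one_mul _).le
  · exact hgx.bdd_mul (c := B) hmθ.restrict (.of_forall hb)

end Estimate

/-! ### Collar, admissible points and cutoff -/

section Geometry

variable {n : ℕ} {q : Fin n → ℝ} {𝕜 : Type*} [RCLike 𝕜]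

theorem contDiffAt_comp_red (hq : ∀ j, 0 < q j) {u : E n → 𝕜} {x : E n} (hx : red q x ∈ cell q)
    (hu : ContDiffAt ℝ ∞ u (red q x)) : ContDiffAt ℝ ∞ (fun y => u (red q y)) x := by
  have h := red_eventually_eq hq hx
  rw [h.self_of_nhds] at hu
  have h1 : ContDiffAt ℝ ∞ (fun y => u (y + latticePoint q (-floorPart q x))) x :=
    ContDiffAt.comp x hu (contDiffAt_id.add contDiffAt_const)
  refine h1.congr_of_eventuallyEq ?_
  filter_upwards [h] with y hy
  rw [hy]

theorem lderiv_comp_red (hq : ∀ j, 0 < q j) (u : E n → 𝕜) {x : E n} (hx : red q x ∈ cell q)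
    (L : List (Fin n)) : lderiv L (fun y => u (red q y)) x = lderiv L u (red q x) := by
  have h := red_eventually_eq hq hx
  have h1 : (fun y => u (red q y)) =ᶠ[𝓝 x]
      fun y => u (y + latticePoint q (-floorPart q x)) := by
    filter_upwards [h] with y hy
    rw [hy]
  rw [((GermLinear.lderiv L).congr _ _ _ h1).self_of_nhds, lderiv_comp_add_right,
    ← h.self_of_nhds]

theorem isCompact_closure_of_subset_cell (hq : ∀ j, 0 < q j) {A : Set (E n)}
    (hA : closure A ⊆ cell q) : IsCompact (closure A) :=
  (isCompact_closure_cell hq).of_isClosed_subset isClosed_closure (hA.trans subset_closure)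

theorem isCompact_frontier_of_subset_cell (hq : ∀ j, 0 < q j) {A : Set (E n)}
    (hA : closure A ⊆ cell q) : IsCompact (frontier A) :=
  (isCompact_closure_of_subset_cell hq hA).of_isClosed_subset isClosed_frontier
    frontier_subset_closure

/-- A closed collar of `∂Ω` stays in the periodicity cell and its differences with
`cl Q ∖ Ω₂` stay in `G`. -/
theorem exists_collar (hq : ∀ j, 0 < q j) {Ω Ω₂ G : Set (E n)} (hΩ : closure Ω ⊆ cell q)
    (hΩ₂ : IsOpen Ω₂) (hG : IsOpen G)
    (hGΩ : ∀ t ∈ closure (cell q) \ Ω₂, ∀ s ∈ frontier Ω, t - s ∈ G) :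
    ∃ δ : ℝ, 0 < δ ∧ Metric.cthickening δ (frontier Ω) ⊆ cell q ∧
      ∀ t ∈ closure (cell q) \ Ω₂, ∀ y ∈ Metric.cthickening δ (frontier Ω), t - y ∈ G := by
  have hK := isCompact_frontier_of_subset_cell hq hΩ
  have hT : IsCompact (closure (cell q) \ Ω₂) := (isCompact_closure_cell hq).diff hΩ₂
  obtain ⟨δ₁, h₁, hs₁⟩ := hK.exists_cthickening_subset_open (isOpen_cell q)
    (frontier_subset_closure.trans hΩ)
  -- The set of differences is compact, so a closed thickening of it stays in `G`; moving `s` by a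
  -- distance moves `t - s` by the same distance.
  obtain ⟨δ₂, h₂, hs₂⟩ := ((hT.prod hK).image
    (f := fun p : E n × E n => p.1 - p.2) (by fun_prop)).exists_cthickening_subset_open hG (by
      rintro _ ⟨⟨t, s⟩, ⟨ht, hs⟩, rfl⟩
      exact hGΩ t ht s hs)
  refine ⟨min δ₁ δ₂, lt_min h₁ h₂, (Metric.cthickening_mono (min_le_left _ _) _).trans hs₁, ?_⟩
  intro t ht y hy
  have hy' := Metric.cthickening_mono (min_le_right δ₁ δ₂) _ hy
  rw [hK.cthickening_eq_biUnion_closedBall h₂.le, mem_iUnion₂] at hy'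
  obtain ⟨s, hs, hys⟩ := hy'
  refine hs₂ (Metric.mem_cthickening_of_dist_le _ (t - s) _ _ ⟨(t, s), ⟨ht, hs⟩, rfl⟩ ?_)
  rwa [dist_sub_left]

/-- The points whose differences with the points of `N` belong to `V`. -/
def admissible (N V : Set (E n)) : Set (E n) := {x | ∀ y ∈ N, x - y ∈ V}

/-- By periodicity of the target set, the condition need only be tested on one copy of `K`. -/
theorem mem_admissible_periodic {K G : Set (E n)} {x : E n} :
    x ∈ admissible (periodicSet q K) (periodicSet q G) ↔ ∀ y ∈ K, x - y ∈ periodicSet q G := by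
  refine ⟨fun h y hy => h y (subset_periodicSet q K hy), fun h y hy => ?_⟩
  obtain ⟨z, a, ha, rfl⟩ := mem_periodicSet.1 hy
  rw [← add_mem_periodicSet z, sub_add_eq_sub_sub, sub_add_cancel]
  exact h a ha

/-- The complement is the sum of a compact and a closed set, hence closed. -/
theorem isOpen_admissible_periodic {K G : Set (E n)} (hK : IsCompact K) (hG : IsOpen G) :
    IsOpen (admissible (periodicSet q K) (periodicSet q G)) := by
  have h : (admissible (periodicSet q K) (periodicSet q G))ᶜ = K + (periodicSet q G)ᶜ := by
    ext x
    rw [mem_compl_iff, mem_admissible_periodic, Set.mem_add]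
    push Not
    constructor
    · rintro ⟨y, hy, h⟩
      exact ⟨y, hy, x - y, h, add_sub_cancel _ _⟩
    · rintro ⟨y, hy, v, hv, rfl⟩
      exact ⟨y, hy, by rwa [add_sub_cancel_left]⟩
  rw [← isClosed_compl_iff, h]
  exact (isOpen_periodicSet hG).isClosed_compl.add_left_of_isCompact hK

theorem isOpen_periodicExt (q : Fin n → ℝ) (Ω : Set (E n)) : IsOpen (periodicExt q Ω) :=
  isClosed_closure.isOpen_compl

theorem notMem_of_mem_closure_periodicExt {Ω : Set (E n)} (hΩ : IsOpen Ω) {x : E n}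
    (hx : x ∈ closure (periodicExt q Ω)) : x ∉ periodicSet q Ω := by
  intro h
  rw [periodicExt, closure_compl] at hx
  exact hx (interior_maximal subset_closure (isOpen_periodicSet hΩ) h)

/-- A point of `cl S[Ω₂]⁻` reduces to a point of `cl Q ∖ Ω₂`, where the collar property applies, and
admissibility is invariant under the lattice. -/
theorem closure_periodicExt_subset_admissible (hq : ∀ j, 0 < q j) {Ω₂ K G : Set (E n)}
    (hΩ₂ : IsOpen Ω₂) (hG : ∀ t ∈ closure (cell q) \ Ω₂, ∀ y ∈ K, t - y ∈ G) :
    closure (periodicExt q Ω₂) ⊆ admissible (periodicSet q K) (periodicSet q G) := by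
  intro x hx
  rw [mem_admissible_periodic]
  intro y hy
  have h1 : red q x ∉ Ω₂ := fun h => notMem_of_mem_closure_periodicExt hΩ₂ hx
    (mem_periodicSet.2 ⟨_, _, h, red_add q x⟩)
  refine mem_periodicSet.2 ⟨floorPart q x, _, hG _ ⟨red_mem hq x, h1⟩ y hy, ?_⟩
  rw [sub_add_eq_add_sub, red_add]

theorem add_mem_periodicExt {Ω : Set (E n)} (hq : ∀ j, 0 < q j) (hΩ : closure Ω ⊆ cell q)
    {x : E n} (z : Fin n → ℤ) :
    x + latticePoint q z ∈ periodicExt q Ω ↔ x ∈ periodicExt q Ω := by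
  rw [periodicExt, closure_periodicSet hq (isCompact_closure_of_subset_cell hq hΩ),
    mem_compl_iff, mem_compl_iff, add_mem_periodicSet]

open scoped Manifold in
-- With `χ` a bump function equal to 1 on the half collar and 0 off the collar, `θ` is `1 - χ ∘
-- red`. The jumps of `red` do no harm: they occur off the periodic collar, where `θ` is locally 1.
theorem exists_cutoff (𝕜 : Type*) [RCLike 𝕜] (hq : ∀ j, 0 < q j) {K : Set (E n)} {δ : ℝ}
    (hδ : 0 < δ) (hK : IsCompact K) (hKc : Metric.cthickening δ K ⊆ cell q) :
    ∃ (c : ℝ) (θ : E n → 𝕜), 0 ≤ c ∧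
      IsCutoff q (periodicSet q K) (periodicSet q (Metric.cthickening δ K)) c θ := by
  obtain ⟨χ, h0, h1, h01⟩ := exists_contMDiffMap_zero_one_of_isClosed 𝓘(ℝ, E n) (n := (⊤ : ℕ∞))
    (s := (Metric.thickening δ K)ᶜ) (t := Metric.cthickening (δ / 2) K)
    Metric.isOpen_thickening.isClosed_compl Metric.isClosed_cthickening
    (disjoint_compl_left_iff_subset.2
      (Metric.cthickening_subset_thickening' hδ (by linarith) _))
  have hχs : ContDiff ℝ ∞ χ := contMDiff_iff_contDiff.1 χ.contMDiff
  have hN : IsClosed (periodicSet q (Metric.cthickening δ K)) :=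
    isClosed_periodicSet hq hK.cthickening
  have hout : ∀ x ∉ periodicSet q (Metric.cthickening δ K), χ (red q x) = 0 := fun x hx => by
    refine h0 fun h => hx ?_
    rw [← red_mem_iff hq hKc]
    exact Metric.thickening_subset_cthickening _ _ h
  set θ : E n → 𝕜 := fun x => ((1 - χ (red q x) : ℝ) : 𝕜) with hθ
  have hsm : ContDiff ℝ ∞ θ := by
    refine contDiff_iff_contDiffAt.2 fun x => ?_
    by_cases hx : red q x ∈ cell q
    · refine contDiffAt_comp_red hq (u := fun y => ((1 - χ y : ℝ) : 𝕜)) hx ?_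
      exact ((RCLike.ofRealCLM (K := 𝕜)).contDiff.comp (contDiff_const.sub hχs)).contDiffAt
    · have hxN : x ∉ periodicSet q (Metric.cthickening δ K) := fun h =>
        hx (hKc ((red_mem_iff hq hKc).2 h))
      refine (contDiffAt_const (c := (1 : 𝕜))).congr_of_eventuallyEq ?_
      filter_upwards [hN.isOpen_compl.mem_nhds hxN] with y hy
      simp [hθ, hout y hy]
  have hper : IsLatticePeriodic q θ := isLatticePeriodic_comp_red hq fun y => ((1 - χ y : ℝ) : 𝕜)
  have hpd : ∀ j : Fin n, ∃ C, ∀ x, ‖pderiv j θ x‖ ≤ C := fun j =>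
    (hper.lderiv [j]).exists_bound hq (contDiff_lderiv hsm [j]).continuous
  choose C hC using hpd
  have hnn : ∀ j, 0 ≤ C j := fun j => (norm_nonneg _).trans (hC j 0)
  refine ⟨∑ j, C j, θ, Finset.sum_nonneg fun j _ => hnn j, hsm, hper, ?_, ?_, ?_, ?_, ?_⟩
  · intro x hx
    have hsub : Metric.thickening (δ / 2) K ⊆ Metric.cthickening δ K :=
      (Metric.thickening_mono (by linarith) K).trans (Metric.thickening_subset_cthickening _ _)
    have hmem : x ∈ periodicSet q (Metric.thickening (δ / 2) K) :=
      periodicSet_mono (Metric.self_subset_thickening (by linarith) K) hx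
    filter_upwards [(isOpen_periodicSet Metric.isOpen_thickening).mem_nhds hmem] with y hy
    have := h1 (Metric.thickening_subset_cthickening _ _
      ((red_mem_iff hq (hsub.trans hKc)).2 hy))
    simp [hθ, this]
  · intro x hx
    simp [hθ, hout x hx]
  · intro x
    have := h01 (red q x)
    rw [hθ, RCLike.norm_ofReal, abs_le]
    constructor <;> linarith [this.1, this.2]
  · intro x
    have := h01 (red q x)
    have e : 1 - θ x = ((χ (red q x) : ℝ) : 𝕜) := by simp [hθ]
    rw [e, RCLike.norm_ofReal, abs_le]
    constructor <;> linarith [this.1, this.2]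
  · exact fun j x => (hC j x).trans (Finset.single_le_sum (fun i _ => hnn i) (Finset.mem_univ j))

end Geometry

/-! ### From Roumieu classes to Roumieu estimates and back -/

section Classes

variable {n : ℕ} {q : Fin n → ℝ} {ρ : ℝ} {𝕜 : Type*} [RCLike 𝕜]

theorem derivExt_apply_of_mem {U : Set (E n)} {u : closure U → 𝕜} (hu : u ∈ smoothSubmodule 𝕜 U)
    (β : Fin n → ℕ) {x : E n} (hx : x ∈ U) :
    derivExt U β u ⟨x, subset_closure hx⟩ = mderiv β (zeroExt u) x := by
  obtain ⟨g, hg, hg'⟩ := hu.2.2 β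
  rw [derivExt_eq hg hg', hg' x hx]

/-- The functions of a Roumieu class satisfy Roumieu estimates. -/
theorem roumieuBound_zeroExt (hρ : 0 < ρ) {U K : Set (E n)} {u : closure U → 𝕜}
    (hu : u ∈ smoothSubmodule 𝕜 U) (hfin : roumieuSup ρ U K u < ⊤) :
    RoumieuBound ρ (roumieuSup ρ U K u).toReal (U ∩ K) (zeroExt u) := by
  refine ⟨fun x hx => hu.2.1 x hx.1, fun L x hx => ?_⟩
  rw [lderiv_eq_mderiv L (hu.2.1 x hx.1), ← derivExt_apply_of_mem hu _ hx.1]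
  set β : Fin n → ℕ := fun j => L.count j
  have h1 : ENNReal.ofReal (ρ ^ (∑ j, β j) / (Nat.factorial (∑ j, β j) : ℝ)) *
      ‖derivExt U β u ⟨x, subset_closure hx.1⟩‖ₑ ≤ roumieuSup ρ U K u := by
    refine le_trans ?_ (le_iSup (fun β : Fin n → ℕ =>
      ENNReal.ofReal (ρ ^ (∑ j, β j) / (Nat.factorial (∑ j, β j) : ℝ)) *
        ⨆ (x : closure U) (_ : (x : E n) ∈ K), ‖derivExt U β u x‖ₑ) β)
    gcongr
    exact le_iSup₂ (f := fun (x : closure U) (_ : (x : E n) ∈ K) => ‖derivExt U β u x‖ₑ)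
      ⟨x, subset_closure hx.1⟩ hx.2
  have h2 := ENNReal.toReal_mono hfin.ne h1
  rw [show ∑ j, β j = L.length from sum_count_eq_length L, ENNReal.toReal_mul, toReal_enorm,
    ENNReal.toReal_ofReal (by positivity)] at h2
  have hp : 0 < ρ ^ L.length / (Nat.factorial L.length : ℝ) := by positivity
  calc _ ≤ (roumieuSup ρ U K u).toReal / (ρ ^ L.length / (Nat.factorial L.length : ℝ)) :=
        (le_div_iff₀' hp).2 h2
    _ = _ := by field_simp

/-- Since `F` is smooth at every point of the closure, its own derivatives are the required
continuous extensions. -/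
theorem restrict_mem_smoothSubmodule {U W : Set (E n)} {M : ℝ} (hU : IsOpen U) (hUW : closure U ⊆ W)
    {F : E n → 𝕜} (hF : RoumieuBound ρ M W F) :
    (fun x : closure U => F x) ∈ smoothSubmodule 𝕜 U ∧
      ∀ β x, derivExt U β (fun x : closure U => F x) x = mderiv β F x := by
  have heq : ∀ x ∈ U, zeroExt (fun x : closure U => F x) =ᶠ[𝓝 x] F := fun x hx => by
    filter_upwards [hU.mem_nhds hx] with y hy
    rw [zeroExt_apply _ (subset_closure hy)]
  have hc : ∀ β, Continuous fun x : closure U => mderiv β F x := fun β => by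
    rw [continuous_iff_continuousAt]
    intro x
    exact ((GermLinear.mderiv β).smooth _ _ (hF.smooth x (hUW x.2))).continuousAt.comp
      continuous_subtype_val.continuousAt
  have hval : ∀ β, ∀ x (hx : x ∈ U),
      mderiv β F x = mderiv β (zeroExt fun x : closure U => F x) x := fun β x hx =>
    ((GermLinear.mderiv β).congr _ _ _ (heq x hx)).self_of_nhds.symm
  refine ⟨⟨?_, fun x hx => ?_, fun β => ⟨_, hc β, hval β⟩⟩, fun β x => ?_⟩
  · rw [continuous_iff_continuousAt]
    intro x
    exact (hF.smooth x (hUW x.2)).continuousAt.comp continuous_subtype_val.continuousAt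
  · exact (hF.smooth x (hUW (subset_closure hx))).congr_of_eventuallyEq (heq x hx)
  · exact congrFun (derivExt_eq (hc β) (hval β)) x

theorem RoumieuBound.norm_mderiv_le {W : Set (E n)} {M : ℝ} {F : E n → 𝕜}
    (hF : RoumieuBound ρ M W F) (β : Fin n → ℕ) {x : E n} (hx : x ∈ W) :
    ‖mderiv β F x‖ ≤ M * ((Nat.factorial (∑ j, β j) : ℝ) / ρ ^ (∑ j, β j)) := by
  rw [mderiv_eq_lderiv, ← length_multiIndexList]
  exact hF.bound _ x hx

/-- A periodic function with Roumieu estimates near `cl S[Ω]⁻` belongs to the periodic Roumieu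
class. -/
theorem restrict_mem_roumieuExt (hρ : 0 < ρ) {Ω W : Set (E n)} {M : ℝ}
    (hW : closure (periodicExt q Ω) ⊆ W) {F : E n → 𝕜} (hF : RoumieuBound ρ M W F)
    (hp : IsLatticePeriodic q F) :
    ∃ h : (fun x : closure (periodicExt q Ω) => F x) ∈ roumieuExtSubmodule 𝕜 q ρ Ω,
      0 ≤ M → roumieuExtNorm 𝕜 q ρ Ω ⟨_, h⟩ ≤ M := by
  obtain ⟨hs, hd⟩ := restrict_mem_smoothSubmodule (isOpen_periodicExt q Ω) hW hF
  have hsup : roumieuSup ρ (periodicExt q Ω) (closure (cell q) \ Ω)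
      (fun x : closure (periodicExt q Ω) => F x) ≤ ENNReal.ofReal M := by
    refine iSup_le fun β => ?_
    simp only [ENNReal.mul_iSup]
    refine iSup₂_le fun x _ => ?_
    rw [hd, ← ofReal_norm, ← ENNReal.ofReal_mul (by positivity)]
    refine ENNReal.ofReal_le_ofReal ?_
    refine (mul_le_mul_of_nonneg_left (hF.norm_mderiv_le β (hW x.2)) (by positivity)).trans ?_
    apply le_of_eq
    field_simp
  refine ⟨⟨⟨hs, fun β => ⟨M * ((Nat.factorial (∑ j, β j) : ℝ) / ρ ^ (∑ j, β j)), fun x => ?_⟩, fun j x y hxy => ?_⟩,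
    hsup.trans_lt ENNReal.ofReal_lt_top⟩, fun hM => ?_⟩
  · rw [hd]
    exact hF.norm_mderiv_le β (hW x.2)
  · change F y = F x
    rw [hxy, ← latticePoint_single]
    exact hp _ _
  · exact ENNReal.toReal_le_of_le_ofReal hM hsup

/-- The periodic extension by zero of a function on `cl Ω`, restricted to `Ω`. -/
def interiorDensity (q : Fin n → ℝ) (Ω : Set (E n)) (φ : closure Ω → 𝕜) (x : E n) : 𝕜 :=
  Ω.indicator (zeroExt φ) (red q x)

/-- The extension by zero of the restriction to `S[Ω]⁻` of a function on its closure. -/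
def exteriorDensity (q : Fin n → ℝ) (Ω : Set (E n)) (φ : closure (periodicExt q Ω) → 𝕜) :
    E n → 𝕜 :=
  (periodicExt q Ω).indicator (zeroExt φ)

theorem isClosed_periodicSet_frontier (hq : ∀ j, 0 < q j) {Ω : Set (E n)}
    (hΩ : closure Ω ⊆ cell q) : IsClosed (periodicSet q (frontier Ω)) :=
  isClosed_periodicSet hq (isCompact_frontier_of_subset_cell hq hΩ)

theorem RoumieuBound.of_eventuallyEq_zero {O : Set (E n)} {B : ℝ} (hρ : 0 < ρ) (hB : 0 ≤ B)
    {f : E n → 𝕜} (h : ∀ x ∈ O, f =ᶠ[𝓝 x] 0) : RoumieuBound ρ B O f where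
  smooth x hx := (contDiffAt_const (c := (0 : 𝕜))).congr_of_eventuallyEq (h x hx)
  bound L x hx := by
    rw [((GermLinear.lderiv L).congr _ _ _ (h x hx)).self_of_nhds, lderiv_zero]
    simp only [Pi.zero_apply, norm_zero]
    positivity

/-- Off the periodic boundary, a point either reduces to a point of `Ω`, near which the density is a
translate of `φ`, or lies outside the closed set `S[cl Ω]`, and the density vanishes near it. -/
theorem roumieuBound_interiorDensity (hq : ∀ j, 0 < q j) (hρ : 0 < ρ) {Ω : Set (E n)}
    (hΩo : IsOpen Ω) (hΩ : closure Ω ⊆ cell q) (φ : Roumieu 𝕜 ρ Ω) :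
    RoumieuBound ρ ‖φ‖ (periodicSet q (frontier Ω))ᶜ (interiorDensity q Ω φ.toFun) := by
  have hb : RoumieuBound ρ ‖φ‖ Ω (Ω.indicator (zeroExt φ.toFun)) := by
    have := roumieuBound_zeroExt hρ φ.2.1 φ.2.2
    rw [inter_eq_left.2 subset_closure] at this
    exact this.congr hΩo fun x hx => indicator_of_mem hx _
  have hin : ∀ x, red q x ∈ Ω → red q x ∈ cell q := fun x hx => hΩ (subset_closure hx)
  have hout : ∀ x ∈ (periodicSet q (frontier Ω))ᶜ, red q x ∉ Ω →
      interiorDensity q Ω φ.toFun =ᶠ[𝓝 x] 0 := by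
    intro x hx hxΩ
    have hx' : x ∉ periodicSet q (closure Ω) := by
      rw [← red_mem_iff hq hΩ]
      rw [mem_compl_iff, ← red_mem_iff hq (frontier_subset_closure.trans hΩ), hΩo.frontier_eq] at hx
      exact fun h => hx ⟨h, hxΩ⟩
    have hcl := isClosed_periodicSet hq (isCompact_closure_of_subset_cell hq hΩ)
    filter_upwards [hcl.isOpen_compl.mem_nhds hx'] with y hy
    refine indicator_of_notMem (fun h => hy ?_) _
    exact (red_mem_iff hq hΩ).1 (subset_closure h)
  refine ⟨fun x hx => ?_, fun L x hx => ?_⟩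
  · by_cases h : red q x ∈ Ω
    · exact contDiffAt_comp_red hq (hin x h) (hb.smooth _ h)
    · exact (RoumieuBound.of_eventuallyEq_zero hρ (norm_nonneg φ)
        (O := {x}) fun y hy => by rw [mem_singleton_iff.1 hy]; exact hout x hx h).smooth x rfl
  · by_cases h : red q x ∈ Ω
    · exact (congrArg _ (lderiv_comp_red hq _ (hin x h) L)).trans_le (hb.bound L _ h)
    · exact (RoumieuBound.of_eventuallyEq_zero hρ (norm_nonneg φ)
        (O := {x}) fun y hy => by rw [mem_singleton_iff.1 hy]; exact hout x hx h).bound L x rfl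

theorem interiorDensity_eq_zero (hq : ∀ j, 0 < q j) {Ω : Set (E n)} (hΩo : IsOpen Ω)
    (hΩ : closure Ω ⊆ cell q) (φ : closure Ω → 𝕜) {x : E n} (hx : x ∈ periodicSet q (frontier Ω)) :
    interiorDensity q Ω φ x = 0 := by
  rw [← red_mem_iff hq (frontier_subset_closure.trans hΩ), hΩo.frontier_eq] at hx
  exact indicator_of_notMem hx.2 _

theorem exteriorDensity_periodic (hq : ∀ j, 0 < q j) {Ω : Set (E n)}
    (hΩ : closure Ω ⊆ cell q) (φ : RoumieuExt 𝕜 q ρ Ω) :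
    IsLatticePeriodic q (exteriorDensity q Ω φ.toFun) := by
  refine isLatticePeriodic_of_single fun j x => ?_
  rw [← latticePoint_single]
  unfold exteriorDensity
  have hiff := add_mem_periodicExt hq hΩ (x := x) (Pi.single j 1)
  by_cases h : x ∈ periodicExt q Ω
  · rw [indicator_of_mem h, indicator_of_mem (hiff.2 h), zeroExt_apply _ (subset_closure h),
      zeroExt_apply _ (subset_closure (hiff.2 h))]
    exact φ.2.1.2.2 j _ _ (congrArg (x + ·) (latticePoint_single q j))
  · rw [indicator_of_notMem h, indicator_of_notMem (mt hiff.1 h)]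

theorem exteriorDensity_eq_zero (hq : ∀ j, 0 < q j) {Ω : Set (E n)}
    (hΩ : closure Ω ⊆ cell q) (φ : closure (periodicExt q Ω) → 𝕜) {x : E n}
    (hx : x ∈ periodicSet q (frontier Ω)) : exteriorDensity q Ω φ x = 0 := by
  refine indicator_of_notMem (fun h => notMem_of_mem_compl h ?_) _
  rw [closure_periodicSet hq (isCompact_closure_of_subset_cell hq hΩ)]
  exact periodicSet_mono frontier_subset_closure hx

/-- The norm only sees points of `cl Q ∖ Ω`; periodicity of the derivatives moves every point of
`S[Ω]⁻` there. The remaining points off the periodic boundary lie in the open set `S[Ω]`, where the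
density is zero. -/
theorem roumieuBound_exteriorDensity (hq : ∀ j, 0 < q j) (hρ : 0 < ρ) {Ω : Set (E n)}
    (hΩo : IsOpen Ω) (hΩ : closure Ω ⊆ cell q) (φ : RoumieuExt 𝕜 q ρ Ω) :
    RoumieuBound ρ ‖φ‖ (periodicSet q (frontier Ω))ᶜ (exteriorDensity q Ω φ.toFun) := by
  have hp := exteriorDensity_periodic hq hΩ φ
  have hU := isOpen_periodicExt q Ω
  have heq : EqOn (exteriorDensity q Ω φ.toFun) (zeroExt φ.toFun) (periodicExt q Ω) :=
    fun x hx => indicator_of_mem hx _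
  have hb := roumieuBound_zeroExt hρ φ.2.1.1 φ.2.2
  have hout : ∀ x ∈ (periodicSet q (frontier Ω))ᶜ, x ∉ periodicExt q Ω →
      exteriorDensity q Ω φ.toFun =ᶠ[𝓝 x] 0 := by
    intro x hx hxU
    rw [periodicExt, mem_compl_iff, not_not,
      closure_periodicSet hq (isCompact_closure_of_subset_cell hq hΩ), ← red_mem_iff hq hΩ] at hxU
    rw [mem_compl_iff, ← red_mem_iff hq (frontier_subset_closure.trans hΩ), hΩo.frontier_eq] at hx
    have hxΩ : x ∈ periodicSet q Ω :=
      (red_mem_iff hq (subset_closure.trans hΩ)).1 (by by_contra h; exact hx ⟨hxU, h⟩)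
    filter_upwards [(isOpen_periodicSet hΩo).mem_nhds hxΩ] with y hy
    exact indicator_of_notMem (fun h => notMem_of_mem_compl h (subset_closure hy)) _
  refine ⟨fun x hx => ?_, fun L x hx => ?_⟩
  · by_cases h : x ∈ periodicExt q Ω
    · exact (φ.2.1.1.2.1 x h).congr_of_eventuallyEq (heq.eventuallyEq_of_mem (hU.mem_nhds h))
    · exact (RoumieuBound.of_eventuallyEq_zero hρ (norm_nonneg φ)
        (O := {x}) fun y hy => by rw [mem_singleton_iff.1 hy]; exact hout x hx h).smooth x rfl
  · by_cases h : x ∈ periodicExt q Ω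
    · have hr : red q x ∈ periodicExt q Ω := by
        rw [← add_mem_periodicExt hq hΩ (floorPart q x), red_add]
        exact h
      have hr' : red q x ∉ Ω := fun h' =>
        notMem_of_mem_closure_periodicExt hΩo (subset_closure hr) (subset_periodicSet q Ω h')
      rw [← (hp.lderiv L).red, lderiv_eqOn hU heq L hr]
      exact hb.bound L _ ⟨hr, red_mem hq x, hr'⟩
    · exact (RoumieuBound.of_eventuallyEq_zero hρ (norm_nonneg φ)
        (O := {x}) fun y hy => by rw [mem_singleton_iff.1 hy]; exact hout x hx h).bound L x rfl

end Classes

/-! ### Integrability and Roumieu estimates of the kernels -/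

section Kernels

variable {n : ℕ} {q : Fin n → ℝ} {lam ρ : ℝ} {𝕜 : Type*} [RCLike 𝕜]

theorem zeroExt_of_notMem {s : Set (E n)} (u : s → 𝕜) {x : E n} (hx : x ∉ s) :
    zeroExt u x = 0 :=
  Function.extend_apply' _ _ _ fun ⟨a, ha⟩ => hx (ha ▸ a.2)

theorem add_mem_lattice {x : E n} (z : Fin n → ℤ) :
    x + latticePoint q z ∈ lattice q ↔ x ∈ lattice q := by
  have h : ∀ y, y ∈ lattice q ↔ y ∈ (latticeHom q).range := fun y => Iff.rfl
  rw [h, h]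
  exact AddSubgroup.add_mem_cancel_right _ ⟨z, rfl⟩

theorem zeroExt_kernel_periodic {h : ((lattice q)ᶜ : Set (E n)) → 𝕜}
    (hh : h ∈ contPeriodicSubmodule 𝕜 q) : IsLatticePeriodic q (zeroExt h) := fun z x => by
  by_cases hx : x ∈ lattice q
  · rw [zeroExt_of_notMem h (not_not.2 hx), zeroExt_of_notMem h (not_not.2 ((add_mem_lattice z).2 hx))]
  · rw [zeroExt_apply h (x := x) hx, zeroExt_apply h (mt (add_mem_lattice z).1 hx)]
    exact hh.2 z _ _ rfl

theorem aestronglyMeasurable_zeroExt {s : Set (E n)} (hs : IsOpen s) {u : s → 𝕜}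
    (hu : Continuous u) : AEStronglyMeasurable (zeroExt u) := by
  have h : zeroExt u = s.indicator (zeroExt u) :=
    (indicator_eq_self.2 fun x hx => by
      by_contra h; exact hx (zeroExt_of_notMem u h)).symm
  rw [h, aestronglyMeasurable_indicator_iff hs.measurableSet]
  refine ContinuousOn.aestronglyMeasurable ?_ hs.measurableSet
  rw [continuousOn_iff_continuous_domRestrict]
  convert hu using 1
  funext x
  exact zeroExt_apply u x.2

theorem norm_zeroExt_kernel_le {h : ((lattice q)ᶜ : Set (E n)) → 𝕜} (hfin : kernelSup q lam h < ⊤)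
    {x : E n} (hx : x ∈ centredCell q) :
    ‖zeroExt h x‖ ≤ (kernelSup q lam h).toReal * ‖x‖ ^ (-lam) := by
  by_cases hxl : x ∈ lattice q
  · rw [zeroExt_of_notMem h (not_not.2 hxl), norm_zero]
    positivity
  · have hx0 : x ≠ 0 := fun h0 => hxl ⟨0, by rw [latticePoint_zero, h0]⟩
    have h1 : ‖h ⟨x, hxl⟩‖ₑ * ENNReal.ofReal (‖x‖ ^ lam) ≤ kernelSup q lam h :=
      le_iSup₂ (f := fun (x : ((lattice q)ᶜ : Set (E n)))
        (_ : (x : E n) ∈ centredCell q \ {0}) =>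
        ‖h x‖ₑ * ENNReal.ofReal (‖(x : E n)‖ ^ lam)) ⟨x, hxl⟩ ⟨hx, hx0⟩
    have h2 := ENNReal.toReal_mono hfin.ne h1
    rw [ENNReal.toReal_mul, toReal_enorm, ENNReal.toReal_ofReal (by positivity)] at h2
    rw [zeroExt_apply h hxl, Real.rpow_neg (norm_nonneg _), ← div_eq_mul_inv,
      le_div_iff₀ (Real.rpow_pos_of_pos (norm_pos_iff.2 hx0) _)]
    exact h2

/-- The kernels in `A⁰_{q,lam}` are integrable over the periodicity cell, with a bound on the
integral that depends linearly on the norm. -/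
theorem exists_integral_kernel_le (𝕜 : Type*) [RCLike 𝕜] (hq : ∀ j, 0 < q j) (hn : 1 ≤ n)
    (hlam : lam < n) :
    ∃ K : ℝ, 0 ≤ K ∧ ∀ h ∈ kernelSubmodule₀ 𝕜 q lam, IntegrableOn (zeroExt h) (cell q) ∧
      ∫ y in cell q, ‖zeroExt h y‖ ≤ K * (kernelSup q lam h).toReal := by
  -- Reflection through the centre of the cell carries `Q` to the centred cell, where the norm
  -- bounds `|h(x)|` by a multiple of `‖x‖ ^ (-lam)`, locally integrable as `lam < n`.
  set c : E n := WithLp.toLp 2 fun j => q j / 2 with hc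
  have hcell : ∀ y ∈ cell q, c - y ∈ centredCell q := fun y hy j => by
    have := hy j
    simp only [hc, PiLp.sub_apply]
    constructor <;> linarith
  have hloc : LocallyIntegrable (fun y : E n => ‖y‖ ^ (-lam)) := by
    refine locallyIntegrable_of_norm_le_rpow (C := 1) (α := lam) ?_ ?_ (.of_forall fun y => ?_) ?_
    · simpa using hn
    · simpa using hlam
    · rw [one_mul, Real.norm_of_nonneg (by positivity)]
    · exact (measurable_norm.pow_const _).aestronglyMeasurable
  have hint : IntegrableOn (fun y : E n => ‖c - y‖ ^ (-lam)) (cell q) := by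
    have h1 : IsCompact ((fun y => c - y) '' closure (cell q)) :=
      (isCompact_closure_cell hq).image (by fun_prop)
    have h2 := (hloc.integrableOn_isCompact h1).mono_set (image_mono subset_closure)
    exact ((Measure.measurePreserving_sub_left volume c).integrableOn_image
      (MeasurableEquiv.subLeft c).measurableEmbedding).1 h2
  refine ⟨∫ y in cell q, ‖c - y‖ ^ (-lam), integral_nonneg fun y => by positivity, ?_⟩
  intro h hh
  have hper := zeroExt_kernel_periodic hh.1
  have hm := aestronglyMeasurable_zeroExt (isClosed_lattice hq).isOpen_compl hh.1.1
  have hmc : AEStronglyMeasurable (fun y => zeroExt h (c - y)) := hm.comp_quasiMeasurePreserving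
    (Measure.measurePreserving_sub_left volume c).quasiMeasurePreserving
  have hle : ∀ y ∈ cell q, ‖zeroExt h (c - y)‖ ≤ (kernelSup q lam h).toReal * ‖c - y‖ ^ (-lam) :=
    fun y hy => norm_zeroExt_kernel_le hh.2 (hcell y hy)
  have hle' := ae_restrict_of_forall_mem (μ := volume) (isOpen_cell q).measurableSet hle
  have hi : IntegrableOn (fun y => zeroExt h (c - y)) (cell q) :=
    (hint.const_mul _).mono' hmc.restrict hle'
  constructor
  -- Reflecting a second time gives back `zeroExt h`.
  · simpa using integrableOn_cell_sub hq (hper.const_sub c) hmc hi c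
  · rw [← setIntegral_cell_sub hq (f := fun y => ‖zeroExt h y‖)
      (fun z x => congrArg _ (hper z x)) c, mul_comm, ← integral_const_mul]
    exact integral_mono_ae hi.norm (hint.const_mul _) hle'

theorem norm_kernel_eq {G : Set (E n)} (h : Kernel 𝕜 q lam ρ G) :
    ‖h‖ = ((kernelSup q lam h.toFun).toReal +
      (∑ j, (kernelNorm₀ 𝕜 q (lam + 1)).comp (kernelDerivₗ 𝕜 q lam j))
        (kernelToA₁ 𝕜 q lam ρ G h)) +
      (roumieuSup ρ G (closure G) (restrictTo 𝕜 G h.toFun)).toReal := rfl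

theorem kernelSup_toReal_le_norm {G : Set (E n)} (h : Kernel 𝕜 q lam ρ G) :
    (kernelSup q lam h.toFun).toReal ≤ ‖h‖ := by
  rw [norm_kernel_eq]
  have h1 := apply_nonneg (∑ j, (kernelNorm₀ 𝕜 q (lam + 1)).comp (kernelDerivₗ 𝕜 q lam j))
    (kernelToA₁ 𝕜 q lam ρ G h)
  have h2 := ENNReal.toReal_nonneg (a := roumieuSup ρ G (closure G) (restrictTo 𝕜 G h.toFun))
  linarith

theorem roumieuSup_toReal_le_norm {G : Set (E n)} (h : Kernel 𝕜 q lam ρ G) :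
    (roumieuSup ρ G (closure G) (restrictTo 𝕜 G h.toFun)).toReal ≤ ‖h‖ := by
  rw [norm_kernel_eq]
  have h1 := apply_nonneg (∑ j, (kernelNorm₀ 𝕜 q (lam + 1)).comp (kernelDerivₗ 𝕜 q lam j))
    (kernelToA₁ 𝕜 q lam ρ G h)
  have h2 := ENNReal.toReal_nonneg (a := kernelSup q lam h.toFun)
  linarith

/-- The kernels in `H_q^{lam,ρ}(G)` satisfy Roumieu estimates on `S[G]`. -/
theorem roumieuBound_kernel (hρ : 0 < ρ) {G : Set (E n)} (hG : IsOpen G)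
    (h : Kernel 𝕜 q lam ρ G) : RoumieuBound ρ ‖h‖ (periodicSet q G) (zeroExt h.toFun) := by
  have hp : IsLatticePeriodic q (zeroExt h.toFun) := zeroExt_kernel_periodic h.2.1.2.1.1
  have h1 := roumieuBound_zeroExt hρ h.2.2.1 h.2.2.2
  rw [inter_eq_left.2 subset_closure] at h1
  have hG' : RoumieuBound ρ ‖h‖ G (zeroExt h.toFun) :=
    (h1.congr hG fun x hx => (zeroExt_apply (restrictTo 𝕜 G h.toFun) (subset_closure hx)).symm).mono
      hρ (roumieuSup_toReal_le_norm h)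
  refine ⟨fun x hx => ?_, fun L x hx => ?_⟩
  · obtain ⟨z, a, ha, rfl⟩ := mem_periodicSet.1 hx
    -- The kernel is its own translate, so smoothness at `a` passes to `a + latticePoint q z`.
    have hp' : zeroExt h.toFun = fun y => zeroExt h.toFun (y + latticePoint q (-z)) :=
      funext fun y => (hp _ _).symm
    rw [hp']
    refine ContDiffAt.comp (a + latticePoint q z) (g := zeroExt h.toFun)
      (f := fun y => y + latticePoint q (-z)) ?_ (contDiffAt_id.add contDiffAt_const)
    rw [latticePoint_neg, add_neg_cancel_right]
    exact hG'.smooth a ha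
  · obtain ⟨z, a, ha, rfl⟩ := mem_periodicSet.1 hx
    rw [hp.lderiv L z a]
    exact hG'.bound L a ha

end Kernels

/-! ### Potentials as continuous bilinear operators -/

section Potentials

variable {n : ℕ} {q : Fin n → ℝ} {lam ρ : ℝ} {𝕜 : Type*} [RCLike 𝕜]

/-- The function underlying a kernel, as a linear map. -/
def Kernel.toFunₗ (𝕜 : Type*) [RCLike 𝕜] (q : Fin n → ℝ) (lam ρ : ℝ) (G : Set (E n)) :
    Kernel 𝕜 q lam ρ G →ₗ[𝕜] (((lattice q)ᶜ : Set (E n)) → 𝕜) where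
  toFun := Kernel.toFun
  map_add' _ _ := rfl
  map_smul' _ _ := rfl

/-- The function underlying an element of a Roumieu class, as a linear map. -/
def Roumieu.toFunₗ (𝕜 : Type*) [RCLike 𝕜] (ρ : ℝ) (U : Set (E n)) :
    Roumieu 𝕜 ρ U →ₗ[𝕜] (closure U → 𝕜) where
  toFun := Roumieu.toFun
  map_add' _ _ := rfl
  map_smul' _ _ := rfl

/-- The function underlying an element of a periodic Roumieu class, as a linear map. -/
def RoumieuExt.toFunₗ (𝕜 : Type*) [RCLike 𝕜] (q : Fin n → ℝ) (ρ : ℝ) (Ω : Set (E n)) :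
    RoumieuExt 𝕜 q ρ Ω →ₗ[𝕜] (closure (periodicExt q Ω) → 𝕜) where
  toFun := RoumieuExt.toFun
  map_add' _ _ := rfl
  map_smul' _ _ := rfl

/-- A volume potential with Roumieu estimates near `cl S[Ω]⁻` that are linear in the norms of
kernel and density is a continuous bilinear map into the periodic Roumieu class. -/
theorem exists_potential_operator {X Y : Type*} [SeminormedAddCommGroup X] [NormedSpace 𝕜 X]
    [SeminormedAddCommGroup Y] [NormedSpace 𝕜 Y] {s D Ω W : Set (E n)} (hρ : 0 < ρ)
    (a : Y →ₗ[𝕜] (((lattice q)ᶜ : Set (E n)) → 𝕜)) (b : X →ₗ[𝕜] (s → 𝕜))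
    (hint : ∀ h φ x, IntegrableOn (integrand (a h) (b φ) x) D)
    (hper : ∀ h, IsLatticePeriodic q (zeroExt (a h)))
    (hW : closure (periodicExt q Ω) ⊆ W) {C : ℝ} (hC : 0 ≤ C)
    (hb : ∀ h φ, RoumieuBound ρ (C * ‖h‖ * ‖φ‖) W
      (fun x => ∫ y in D, integrand (a h) (b φ) x y)) :
    ∃ T : Y →ₗ[𝕜] X →ₗ[𝕜] RoumieuExt 𝕜 q ρ Ω,
      (∀ h φ (x : closure (periodicExt q Ω)),
        (T h φ).toFun x = ∫ y in D, integrand (a h) (b φ) x y) ∧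
      Continuous (fun p : Y × X => T p.1 p.2) := by
  have hp : ∀ h φ, IsLatticePeriodic q (fun x => ∫ y in D, integrand (a h) (b φ) x y) :=
    fun h φ z x => by
      simp only [integrand]
      refine integral_congr_ae (.of_forall fun y => ?_)
      change zeroExt (a h) (x + latticePoint q z - y) * _ = _
      rw [← sub_add_eq_add_sub, hper h]
  have hmem := fun h φ => restrict_mem_roumieuExt hρ hW (hb h φ) (hp h φ)
  choose hm hn using hmem
  let T : Y →ₗ[𝕜] X →ₗ[𝕜] RoumieuExt 𝕜 q ρ Ω := LinearMap.mk₂ 𝕜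
    (fun h φ => (⟨_, hm h φ⟩ : roumieuExtSubmodule 𝕜 q ρ Ω))
    (fun h h' φ => Subtype.ext <| funext fun x => by
      change ∫ y in D, integrand (a (h + h')) (b φ) x y = _
      refine Eq.trans ?_ (integral_add (hint h φ x) (hint h' φ x))
      simp only [integrand, map_add, Pi.add_apply, add_mul])
    (fun c h φ => Subtype.ext <| funext fun x => by
      change ∫ y in D, integrand (a (c • h)) (b φ) x y = _
      refine Eq.trans ?_ (integral_const_mul c (integrand (a h) (b φ) x))
      simp only [integrand, map_smul, Pi.smul_apply, smul_eq_mul, mul_assoc])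
    (fun h φ φ' => Subtype.ext <| funext fun x => by
      change ∫ y in D, integrand (a h) (b (φ + φ')) x y = _
      refine Eq.trans ?_ (integral_add (hint h φ x) (hint h φ' x))
      simp only [integrand, map_add, Pi.add_apply, mul_add])
    (fun c h φ => Subtype.ext <| funext fun x => by
      change ∫ y in D, integrand (a h) (b (c • φ)) x y = _
      refine Eq.trans ?_ (integral_const_mul c (integrand (a h) (b φ) x))
      simp only [integrand, map_smul, Pi.smul_apply, smul_eq_mul, mul_left_comm])
  -- The constant in the Roumieu estimate bounds the norm in the target, and a bounded bilinear map
  -- is jointly continuous.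
  have hTn : ∀ h φ, ‖T h φ‖ ≤ C * ‖h‖ * ‖φ‖ := fun h φ => hn h φ (by positivity)
  exact ⟨T, fun _ _ _ => rfl, (T.mkContinuous₂ C hTn).continuous₂⟩

/-- The data of the potential estimate for a kernel in `H_q^{lam,ρ}(G)`. -/
theorem potentialData_kernel (hq : ∀ j, 0 < q j) (hρ : 0 < ρ) {Ω G : Set (E n)}
    (hΩ : closure Ω ⊆ cell q) (hG : IsOpen G) {δ c K B : ℝ}
    {θ f : E n → 𝕜} (hc : 0 ≤ c)
    (hθ : IsCutoff q (periodicSet q (frontier Ω))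
      (periodicSet q (Metric.cthickening δ (frontier Ω))) c θ) (hK : 0 ≤ K)
    (hKk : ∀ h ∈ kernelSubmodule₀ 𝕜 q lam, IntegrableOn (zeroExt h) (cell q) ∧
      ∫ y in cell q, ‖zeroExt h y‖ ≤ K * (kernelSup q lam h).toReal)
    (h : Kernel 𝕜 q lam ρ G) (hB : 0 ≤ B) (hfp : IsLatticePeriodic q f)
    (hf0 : ∀ x ∈ periodicSet q (frontier Ω), f x = 0)
    (hfb : RoumieuBound ρ B (periodicSet q (frontier Ω))ᶜ f) :
    PotentialData q ρ ((K + 1) * ‖h‖) B c (periodicSet q (frontier Ω))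
      (periodicSet q (Metric.cthickening δ (frontier Ω))) (periodicSet q G)
      (admissible (periodicSet q (Metric.cthickening δ (frontier Ω))) (periodicSet q G))
      (zeroExt h.toFun) f θ where
  hq := hq
  hρ := hρ
  hc := hc
  hA := by positivity
  hB := hB
  isClosed_S := isClosed_periodicSet_frontier hq hΩ
  isClosed_N := isClosed_periodicSet hq (isCompact_frontier_of_subset_cell hq hΩ).cthickening
  isOpen_V := isOpen_periodicSet hG
  isOpen_W := isOpen_admissible_periodic
    (isCompact_frontier_of_subset_cell hq hΩ).cthickening hG
  sub_mem _ hx := hx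
  g_periodic := zeroExt_kernel_periodic h.2.1.2.1.1
  g_meas := aestronglyMeasurable_zeroExt (isClosed_lattice hq).isOpen_compl h.2.1.2.1.1.1
  g_int := (hKk _ h.2.1.2.1).1
  -- The constant `(K + 1) * ‖h‖` serves twice: `K * ‖h‖` bounds the integral of `|g|`, and `‖h‖` is
  -- the Roumieu constant on `S[G]`.
  g_norm := by
    refine (hKk _ h.2.1.2.1).2.trans ?_
    have h1 := mul_le_mul_of_nonneg_left (kernelSup_toReal_le_norm h) hK
    have h2 := norm_nonneg h
    exact h1.trans (by linarith)
  g_bound := (roumieuBound_kernel hρ hG h).mono hρ (by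
    have h2 := norm_nonneg h
    nlinarith)
  f_periodic := hfp
  f_zero := hf0
  f_bound := hfb
  cutoff := hθ

/-- On the cell `red` is the identity, so integrating the periodic density over `Q` amounts to
integrating `φ` over `Ω`. -/
theorem interiorDensity_mul_eqOn (hq : ∀ j, 0 < q j) (Ω : Set (E n)) (φ : closure Ω → 𝕜)
    (h : ((lattice q)ᶜ : Set (E n)) → 𝕜) (x : E n) :
    EqOn (fun y => zeroExt h (x - y) * interiorDensity q Ω φ y)
      (Ω.indicator (integrand h φ x)) (cell q) := fun y hy => by
  simp only [interiorDensity, red_of_mem_cell hq hy]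
  by_cases hyΩ : y ∈ Ω <;> simp [hyΩ, integrand]

theorem mem_periodicExt_iff_of_mem_cell (hq : ∀ j, 0 < q j) {Ω : Set (E n)}
    (hΩ : closure Ω ⊆ cell q) {y : E n} (hy : y ∈ cell q) :
    y ∈ periodicExt q Ω ↔ y ∉ closure Ω := by
  rw [periodicExt, mem_compl_iff,
    closure_periodicSet hq (isCompact_closure_of_subset_cell hq hΩ),
    mem_periodicSet_of_mem_cell hq hΩ hy]

theorem exteriorDensity_mul_eqOn (hq : ∀ j, 0 < q j) {Ω : Set (E n)} (hΩ : closure Ω ⊆ cell q)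
    (φ : closure (periodicExt q Ω) → 𝕜) (h : ((lattice q)ᶜ : Set (E n)) → 𝕜) (x : E n) :
    EqOn (fun y => zeroExt h (x - y) * exteriorDensity q Ω φ y)
      ((closure Ω)ᶜ.indicator (integrand h φ x)) (cell q) := fun y hy => by
  have := mem_periodicExt_iff_of_mem_cell hq hΩ hy
  by_cases hyΩ : y ∈ closure Ω
  · have h' : y ∉ periodicExt q Ω := fun h => this.1 h hyΩ
    simp [exteriorDensity, h', hyΩ]
  · simp [exteriorDensity, this.2 hyΩ, hyΩ, integrand]

theorem integrableOn_of_eqOn_indicator {Q D : Set (E n)} (hQ : MeasurableSet Q)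
    (hD : MeasurableSet D) {F f : E n → 𝕜} (h : EqOn F (D.indicator f) Q) (hF : IntegrableOn F Q) :
    IntegrableOn f (Q ∩ D) := by
  have h1 := (integrableOn_congr_fun h hQ).1 hF
  rwa [IntegrableOn, integrable_indicator_iff hD, IntegrableOn, Measure.restrict_restrict hD,
    inter_comm] at h1

theorem setIntegral_of_eqOn_indicator {Q D : Set (E n)} (hQ : MeasurableSet Q)
    (hD : MeasurableSet D) {F f : E n → 𝕜} (h : EqOn F (D.indicator f) Q) :
    ∫ y in Q, F y = ∫ y in Q ∩ D, f y := by
  rw [setIntegral_congr_fun hQ h, setIntegral_indicator hD]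

end Potentials

end

end PeriodicRoumieu

/-! ### The theorem -/

open PeriodicRoumieu
theorem theorem3p9 {𝕜 : Type*} [RCLike 𝕜] {n : ℕ} (hn : 2 ≤ n)
    (q : Fin n → ℝ) (hq : ∀ j, 0 < q j)
    (lam ρ : ℝ) (hlam₀ : 0 < lam) (hlam₁ : lam < (n : ℝ) - 1) (hρ : 0 < ρ)
    (Ω Ω₂ G : Set (E n))
    (hΩ : IsBoundedLipschitz Ω) (hΩQ : closure Ω ⊆ cell q)
    (hΩ₂ : IsOpen Ω₂) (hΩΩ₂ : closure Ω ⊆ Ω₂) (hΩ₂Q : closure Ω₂ ⊆ cell q)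
    (hG : IsOpen G) (hGc : IsCompact (closure G)) (hGq : closure G ∩ lattice q = ∅)
    (hGΩ : Ω.Nonempty →
      {x : E n | ∃ t ∈ closure (cell q) \ Ω₂, ∃ s ∈ frontier Ω, x = t - s} ⊆ G)
    (hGe : Ω = ∅ → G = ∅) :
    (Ω.Nonempty →
      (∀ (h : Kernel 𝕜 q lam ρ G) (φ : Roumieu 𝕜 ρ Ω) (x : E n),
        IntegrableOn (integrand h.toFun φ.toFun x) Ω volume) ∧
      ∃ T : Kernel 𝕜 q lam ρ G →ₗ[𝕜] Roumieu 𝕜 ρ Ω →ₗ[𝕜] RoumieuExt 𝕜 q ρ Ω₂,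
        (∀ h φ (x : closure (periodicExt q Ω₂)),
          (T h φ).toFun x = potentialPlus Ω h.toFun φ.toFun x) ∧
        Continuous (fun p : Kernel 𝕜 q lam ρ G × Roumieu 𝕜 ρ Ω => T p.1 p.2)) ∧
    ((∀ (h : Kernel 𝕜 q lam ρ G) (φ : RoumieuExt 𝕜 q ρ Ω) (x : E n),
        IntegrableOn (integrand h.toFun φ.toFun x) (cell q \ closure Ω) volume) ∧
      ∃ T : Kernel 𝕜 q lam ρ G →ₗ[𝕜] RoumieuExt 𝕜 q ρ Ω →ₗ[𝕜] RoumieuExt 𝕜 q ρ Ω₂,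
        (∀ h φ (x : closure (periodicExt q Ω₂)),
          (T h φ).toFun x = potentialMinus Ω h.toFun φ.toFun x) ∧
        Continuous (fun p : Kernel 𝕜 q lam ρ G × RoumieuExt 𝕜 q ρ Ω => T p.1 p.2)) := by
  have hΩo := hΩ.isOpen
  -- For empty `Ω` the boundary is empty and the condition is vacuous. The collar is then empty too
  -- and every point is admissible, so both cases are treated together.
  have hGΩ' : ∀ t ∈ closure (cell q) \ Ω₂, ∀ s ∈ frontier Ω, t - s ∈ G := by
    intro t ht s hs
    refine hGΩ (nonempty_iff_ne_empty.2 fun h0 => ?_) ⟨t, ht, s, hs, rfl⟩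
    simp [h0] at hs
  obtain ⟨δ, hδ, hδc, hδG⟩ := exists_collar hq hΩQ hΩ₂ hG hGΩ'
  obtain ⟨c, θ, hc, hθ⟩ := exists_cutoff 𝕜 hq hδ (isCompact_frontier_of_subset_cell hq hΩQ) hδc
  obtain ⟨K, hK, hKk⟩ := exists_integral_kernel_le (lam := lam) 𝕜 hq (by omega) (by linarith)
  have hW := closure_periodicExt_subset_admissible hq hΩ₂ hδG
  have hQm := (isOpen_cell q).measurableSet
  set v := volume.real (cell q)
  have hv : 0 ≤ v := measureReal_nonneg
  -- The operator bound: the first factor comes from `PotentialData.roumieuBound`, the second from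
  -- the kernel constant `(K + 1) * ‖h‖`.
  have hconst : 0 ≤ (1 + c * v * ρ + v) * (K + 1) := by positivity
  have hper : ∀ h : Kernel 𝕜 q lam ρ G, IsLatticePeriodic q (zeroExt h.toFun) :=
    fun h => zeroExt_kernel_periodic h.2.1.2.1.1
  refine ⟨fun _ => ?_, ?_⟩
  · have hD := fun (h : Kernel 𝕜 q lam ρ G) (φ : Roumieu 𝕜 ρ Ω) =>
      potentialData_kernel (f := interiorDensity q Ω φ.toFun) hq hρ hΩQ hG hc hθ hK hKk h
        (norm_nonneg φ) (isLatticePeriodic_comp_red hq (Ω.indicator (zeroExt φ.toFun)))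
        (fun x hx => interiorDensity_eq_zero hq hΩo hΩQ φ.toFun hx)
        (roumieuBound_interiorDensity hq hρ hΩo hΩQ φ)
    have hsub : cell q ∩ Ω = Ω := inter_eq_right.2 (subset_closure.trans hΩQ)
    have hint : ∀ (h : Kernel 𝕜 q lam ρ G) (φ : Roumieu 𝕜 ρ Ω) (x : E n),
        IntegrableOn (integrand h.toFun φ.toFun x) Ω volume := fun h φ x => by
      have := integrableOn_of_eqOn_indicator hQm hΩo.measurableSet
        (interiorDensity_mul_eqOn hq Ω φ.toFun h.toFun x) ((hD h φ).integrable x)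
      rwa [hsub] at this
    refine ⟨hint, exists_potential_operator hρ (Kernel.toFunₗ 𝕜 q lam ρ G) (Roumieu.toFunₗ 𝕜 ρ Ω)
      hint hper hW hconst fun h φ => ?_⟩
    -- The estimate concerns the cell integral of the periodic density; that integral equals the one
    -- over `Ω`.
    refine ((hD h φ).roumieuBound.congr (hD h φ).isOpen_W fun x _ => ?_).mono hρ
      (le_of_eq (by ring))
    have := setIntegral_of_eqOn_indicator hQm hΩo.measurableSet
      (interiorDensity_mul_eqOn hq Ω φ.toFun h.toFun x)
    rw [hsub] at this
    exact this.symm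
  · have hD := fun (h : Kernel 𝕜 q lam ρ G) (φ : RoumieuExt 𝕜 q ρ Ω) =>
      potentialData_kernel hq hρ hΩQ hG hc hθ hK hKk h (norm_nonneg φ)
        (exteriorDensity_periodic hq hΩQ φ)
        (fun x hx => exteriorDensity_eq_zero hq hΩQ φ.toFun hx)
        (roumieuBound_exteriorDensity hq hρ hΩo hΩQ φ)
    have hcm : MeasurableSet (closure Ω)ᶜ := isClosed_closure.measurableSet.compl
    have hint : ∀ (h : Kernel 𝕜 q lam ρ G) (φ : RoumieuExt 𝕜 q ρ Ω) (x : E n),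
        IntegrableOn (integrand h.toFun φ.toFun x) (cell q \ closure Ω) volume := fun h φ x =>
      integrableOn_of_eqOn_indicator hQm hcm
        (exteriorDensity_mul_eqOn hq hΩQ φ.toFun h.toFun x) ((hD h φ).integrable x)
    refine ⟨hint, exists_potential_operator hρ (Kernel.toFunₗ 𝕜 q lam ρ G)
      (RoumieuExt.toFunₗ 𝕜 q ρ Ω) hint hper hW hconst fun h φ => ?_⟩
    refine ((hD h φ).roumieuBound.congr (hD h φ).isOpen_W fun x _ => ?_).mono hρ
      (le_of_eq (by ring))
    exact (setIntegral_of_eqOn_indicator hQm hcm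
      (exteriorDensity_mul_eqOn hq hΩQ φ.toFun h.toFun x)).symm
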